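/- Let $d\ge 1$ be an integer, let $p,q,\tau\in[1,\infty)$, $0<a\le 1$ and $\alpha,\beta,\gamma\in\mathbb R$, and define $\sigma$ by $\gamma=a\sigma+(1-a)\beta$. Assume the balance law $$\frac1\tau+\frac\gamma d=a\Big(\frac1p+\frac{\alpha-1}d\Big)+(1-a)\Big(\frac1q+\frac\beta d\Big),$$ that $0\le\alpha-\sigma$, and that $\alpha-\sigma\le 1$ if $\frac1\tau+\frac\gamma d=\frac1p+\frac{\alpha-1}d$. Consider, for real-valued $u\in L^1_{loc}(\mathbb R^d\setminus\{0\})$, the inequality $$\big\||x|^\gamma u\big\|_{L^\tau(\mathbb R^d)}\le C\,\big\||x|^\alpha\nabla u\big\|^a_{L^p(\mathbb R^d\setminus\{0\})}\,\big\||x|^\beta u\big\|^{1-a}_{L^q(\mathbb R^d)}.\qquad(*)$$ Here $\nabla u$ is the distributional gradient of $u$ on $\mathbb R^d\setminus\{0\}$, and $\||x|^\alpha\nabla u\|_{L^p(\mathbb R^d\setminus\{0\})}:=\infty$ if $\nabla u\notin[L^p_{loc}(\mathbb R^d\setminus\{0\})]^d$. Both sides of $(*)$ take values in $[0,\infty]$,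 with the conventions $0\cdot\infty=\infty\cdot0=0$, $0^0=\infty^0=1$ and $\infty\le\infty$. Then there is a constant $C>0$, depending only on $d,p,q,\tau,a,\alpha,\beta,\gamma$, such that: (i) if $\frac1\tau+\frac\gamma d>0$, then $(*)$ holds for every $u\in L^1_{loc}(\mathbb R^d\setminus\{0\})$ with compact support in $\mathbb R^d$ (that is, vanishing a.e. outside a compact subset of $\mathbb R^d$, which may contain $0$); (ii) if $\frac1\tau+\frac\gamma d<0$, then $(*)$ holds for every $u\in L^1_{loc}(\mathbb R^d\setminus\{0\})$ that vanishes a.e. in a neighborhood of $0$. -/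

import Mathlib

open MeasureTheory
open scoped ENNReal Topology ContDiff

noncomputable section

/-- `g` is the weak (distributional) gradient of `u` on the punctured space `ℝ^d ∖ {0}`:
`g` is locally integrable there and, for every smooth test function `φ` with compact support in
`ℝ^d ∖ {0}` and every direction `v`, one has `∫ u ∂_v φ = - ∫ ⟨g, v⟩ φ`. -/
def IsWeakGradientPunctured {d : ℕ} (u : EuclideanSpace ℝ (Fin d) → ℝ)
    (g : EuclideanSpace ℝ (Fin d) → EuclideanSpace ℝ (Fin d)) : Prop :=
  LocallyIntegrableOn g {0}ᶜ ∧
    ∀ φ : EuclideanSpace ℝ (Fin d) → ℝ, ContDiff ℝ ∞ φ → HasCompactSupport φ →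
      tsupport φ ⊆ {0}ᶜ → ∀ v : EuclideanSpace ℝ (Fin d),
        ∫ x, u x * fderiv ℝ φ x v = - ∫ x, inner ℝ (g x) v * φ x

/-- `g` belongs to `[L^p_loc(ℝ^d ∖ {0})]^d`. -/
def MemLpLocPunctured {d : ℕ} (g : EuclideanSpace ℝ (Fin d) → EuclideanSpace ℝ (Fin d))
    (p : ℝ) : Prop :=
  ∀ K : Set (EuclideanSpace ℝ (Fin d)), IsCompact K → K ⊆ {0}ᶜ →
    MemLp g (ENNReal.ofReal p) (volume.restrict K)

/-- `‖|x|^γ u‖_{L^p(ℝ^d)}`, with values in `[0, ∞]`. -/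
def weightedLpNorm {d : ℕ} (γ p : ℝ) (u : EuclideanSpace ℝ (Fin d) → ℝ) : ℝ≥0∞ :=
  eLpNorm (fun x => ‖x‖ ^ γ * u x) (ENNReal.ofReal p) volume

/-- `‖|x|^α ∇u‖_{L^p(ℝ^d ∖ {0})}`, with values in `[0, ∞]`, where `∇u` is the weak gradient of `u`
on `ℝ^d ∖ {0}`. The quantity is `∞` when `u` has no weak gradient in `[L^p_loc(ℝ^d ∖ {0})]^d`
(the infimum is then over the empty family); otherwise the weak gradient is unique up to a null set,
so that all members of the family agree. -/
def weightedGradientLpNorm {d : ℕ} (α p : ℝ) (u : EuclideanSpace ℝ (Fin d) → ℝ) : ℝ≥0∞ :=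
  ⨅ (g : EuclideanSpace ℝ (Fin d) → EuclideanSpace ℝ (Fin d))
    (_ : IsWeakGradientPunctured u g ∧ MemLpLocPunctured g p),
    eLpNorm (fun x => ‖x‖ ^ α • g x) (ENNReal.ofReal p) (volume.restrict {0}ᶜ)

/-- The Caffarelli-Kohn-Nirenberg inequality
`‖|x|^γ u‖_{L^τ} ≤ C ‖|x|^α ∇u‖_{L^p(ℝ^d ∖ {0})}^a ‖|x|^β u‖_{L^q}^{1-a}` in `[0, ∞]`, where
`0 * ∞ = ∞ * 0 = 0` and `x ^ 0 = 1` for every `x`, including `x = ∞`. -/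
def CKNInequality {d : ℕ} (C p q τ a α β γ : ℝ) (u : EuclideanSpace ℝ (Fin d) → ℝ) : Prop :=
  weightedLpNorm γ τ u ≤
    ENNReal.ofReal C * (weightedGradientLpNorm α p u ^ a * weightedLpNorm β q u ^ (1 - a))

end

/-! Everything is read off the dyadic increment D(x) = u(2x) - u(x). Put s = d/τ + γ. Doubling the
argument multiplies the norm of |x|^γ u in L^τ by 2^(-s) (`setLp_preimage_smul_eq`), so for s ≠ 0
the relation between u and u(2·) is a strict contraction in one direction, and a geometric series
bounds u by D. The series must start where u vanishes: outside a ball if s > 0, near the origin if s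
< 0. This is the only role of the support conditions, and it works without knowing beforehand that
the norm of u is finite (`setLp_le_of_bounded_support`, `setLp_le_of_vanishing_near_zero`).

The increment is easier to handle than u because, on an annulus, the L^p norm of D is bounded by
that of ∇u on a larger annulus. This replaces a Poincaré inequality: the Gagliardo–Nirenberg
inequality for a cutoff of D has no lower order term (`exists_closedAnnulus_sub_le_of_contDiff`).
Mollification extends it to weak gradients, and dilation gives it at scale l with weights
(`exists_setLp_closedAnnulus_sub_le`); the balance law says that the power of l is then zero.

It remains to sum over l = 2^k. Solving the balance law for 1/τ shows that α - σ ≥ 0 is the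
subcriticality needed on each annulus, and that α - σ ≤ 1 means aτ/p + (1-a)τ/q ≥ 1, so that
Hölder's inequality for sums applies (`exists_setLp_sub_le_of_le`). If α - σ > 1, the subcriticality
is strict and the two norms on the right scale differently. The local inequality then also holds
with a + ε and a - ε, with factors growing in opposite directions in k; the better of the two bounds
is summable, and the sum reproduces the exponent a (`exists_setLp_sub_le_of_lt`).

The unweighted inequality `gagliardoNirenberg` comes from the L^1 Sobolev inequality applied to
|f|^m, combined with Hölder's inequality. -/

/-! ### Unweighted Sobolev and Gagliardo–Nirenberg inequalities -/

/-- Hölder's inequality for three functions, with exponents as weights. -/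
theorem lintegral_rpow_mul_rpow_mul_rpow_le {α : Type*} [MeasurableSpace α] {μ : Measure α}
    {f g h : α → ℝ≥0∞} (hf : AEMeasurable f μ) (hg : AEMeasurable g μ) (hh : AEMeasurable h μ)
    {x y z : ℝ} (hx : 0 ≤ x) (hy : 0 ≤ y) (hz : 0 ≤ z) (hxyz : x + y + z = 1) :
    ∫⁻ t, f t ^ x * (g t ^ y * h t ^ z) ∂μ ≤
      (∫⁻ t, f t ∂μ) ^ x * ((∫⁻ t, g t ∂μ) ^ y * (∫⁻ t, h t ∂μ) ^ z) := by
  have := ENNReal.lintegral_prod_norm_pow_le (μ := μ) (Finset.univ : Finset (Fin 3))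
    (f := ![f, g, h]) (p := ![x, y, z])
    (by
      intro i _
      fin_cases i
      · exact hf
      · exact hg
      · exact hh)
    (by simp [Fin.sum_univ_three, hxyz])
    (by
      intro i _
      fin_cases i
      · exact hx
      · exact hy
      · exact hz)
  simpa [Fin.prod_univ_three, mul_assoc] using this

/-- The fundamental theorem of calculus on a half-line, transported by a linear isometry. It is the
Sobolev inequality for d = 1, where the critical exponent d/(d-1) is infinite. -/
theorem enorm_le_lintegral_enorm_fderiv {f : EuclideanSpace ℝ (Fin 1) → ℝ} (hf : ContDiff ℝ 1 f)
    (hc : HasCompactSupport f) (x : EuclideanSpace ℝ (Fin 1)) :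
    ‖f x‖ₑ ≤ ∫⁻ y, ‖fderiv ℝ f y‖ₑ := by
  let e : ℝ ≃ₗᵢ[ℝ] EuclideanSpace ℝ (Fin 1) :=
    (stdOrthonormalBasis ℝ ℝ).equiv (stdOrthonormalBasis ℝ (EuclideanSpace ℝ (Fin 1)))
      (finCongr (by simp))
  have hfe : ContDiff ℝ 1 (fun t => f (e t)) := hf.comp e.contDiff
  have hce : HasCompactSupport (fun t => f (e t)) :=
    hc.comp_isClosedEmbedding e.toHomeomorph.isClosedEmbedding
  have h1 := HasCompactSupport.enorm_le_lintegral_Ici_deriv hfe hce (e.symm x)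
  rw [e.apply_symm_apply] at h1
  refine h1.trans ((setLIntegral_le_lintegral _ _).trans ?_)
  have h2 : ∀ t, ‖deriv (fun t => f (e t)) t‖ₑ ≤ ‖fderiv ℝ f (e t)‖ₑ := by
    intro t
    have h3 : HasDerivAt (fun t => f (e t)) (fderiv ℝ f (e t) (e 1)) t :=
      ((hf.differentiable one_ne_zero (e t)).hasFDerivAt).comp_hasDerivAt t
        (e.toContinuousLinearEquiv.hasFDerivAt.hasDerivAt)
    rw [h3.deriv]
    refine (ContinuousLinearMap.le_opENorm _ _).trans ?_
    have : ‖e 1‖ₑ = 1 := by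
      rw [← ofReal_norm, e.norm_map]; simp
    rw [this, mul_one]
  refine (lintegral_mono h2).trans (le_of_eq ?_)
  exact (e.measurePreserving.lintegral_comp_emb e.toHomeomorph.measurableEmbedding
    (fun y => ‖fderiv ℝ f y‖ₑ))

/-- The Sobolev inequality for `W^{1,1}` functions supported in a set of finite measure, for all
subcritical exponents. -/
theorem exists_lintegral_rpow_le_lintegral_fderiv {d : ℕ} (hd : 1 ≤ d)
    {K : Set (EuclideanSpace ℝ (Fin d))} (hK : volume K ≠ ⊤) {ρ : ℝ} (hρ : 0 < ρ)
    (hρd : 1 - 1 / (d : ℝ) ≤ 1 / ρ) :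
    ∃ C : ℝ≥0∞, C ≠ ⊤ ∧ ∀ f : EuclideanSpace ℝ (Fin d) → ℝ, ContDiff ℝ 1 f →
      HasCompactSupport f → (∀ x ∉ K, f x = 0) →
      (∫⁻ x, ‖f x‖ₑ ^ ρ) ^ (1 / ρ) ≤ C * ∫⁻ x, ‖fderiv ℝ f x‖ₑ := by
  have key : ∀ f : EuclideanSpace ℝ (Fin d) → ℝ, (∀ x ∉ K, f x = 0) →
      ∫⁻ x, ‖f x‖ₑ ^ ρ = ∫⁻ x in K, ‖f x‖ₑ ^ ρ := by
    intro f hfK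
    symm
    apply setLIntegral_eq_of_support_subset
    intro x hx
    by_contra hxK
    simp [hfK x hxK, hρ] at hx
  rcases hd.eq_or_lt with rfl | hd2
  · refine ⟨volume K ^ (1 / ρ), ENNReal.rpow_ne_top_of_nonneg (by positivity) hK, ?_⟩
    intro f hf hc hfK
    rw [key f hfK]
    set S := ∫⁻ x, ‖fderiv ℝ f x‖ₑ
    calc (∫⁻ x in K, ‖f x‖ₑ ^ ρ) ^ (1 / ρ) ≤ (∫⁻ x in K, S ^ ρ) ^ (1 / ρ) := by
          gcongr with x
          exact enorm_le_lintegral_enorm_fderiv hf hc x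
      _ = volume K ^ (1 / ρ) * S := by
          rw [setLIntegral_const, ENNReal.mul_rpow_of_nonneg _ _ (by positivity),
            ← ENNReal.rpow_mul, mul_one_div_cancel hρ.ne', ENNReal.rpow_one, mul_comm]
  · have hd2' : (1 : ℝ) < d := by exact_mod_cast hd2
    -- The conjugate exponent r of d is the critical exponent d/(d-1). A smaller ρ follows by
    -- Hölder's inequality on K, at the cost of a power of the volume of K.
    have hconj := Real.HolderConjugate.conjExponent hd2'
    set r := Real.conjExponent (d : ℝ) with hr
    have hr0 : 0 < r := hconj.symm.pos
    have hr1 : 1 - 1 / (d : ℝ) = 1 / r := by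
      have := hconj.inv_add_inv_eq_one
      simp only [one_div]; linarith
    rw [hr1] at hρd
    have hρr : ρ ≤ r := (one_div_le_one_div hr0 hρ).1 hρd
    have hxy : ρ / r ≤ 1 := (div_le_one hr0).2 hρr
    set C0 : ℝ≥0∞ := (lintegralPowLePowLIntegralFDerivConst
      (volume : Measure (EuclideanSpace ℝ (Fin d))) r : ℝ≥0∞) with hC0
    refine ⟨C0 ^ (1 / r) * volume K ^ ((1 - ρ / r) * (1 / ρ)),
      ENNReal.mul_ne_top (ENNReal.rpow_ne_top_of_nonneg (by positivity) (by simp [hC0]))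
        (ENNReal.rpow_ne_top_of_nonneg
          (mul_nonneg (by linarith) (by positivity)) hK), ?_⟩
    intro f hf hc hfK
    have h1 := lintegral_pow_le_pow_lintegral_fderiv
      (volume : Measure (EuclideanSpace ℝ (Fin d))) hf hc (p := r) (by simpa using hconj)
    set S := ∫⁻ x, ‖fderiv ℝ f x‖ₑ
    have hm : Measurable fun x => ‖f x‖ₑ ^ r := (hf.continuous.measurable.enorm).pow_const _
    have h2 := ENNReal.lintegral_mul_norm_pow_le (μ := volume.restrict K)
      hm.aemeasurable (aemeasurable_const (b := (1 : ℝ≥0∞))) (p := ρ / r) (q := 1 - ρ / r)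
      (by positivity) (by linarith) (by ring)
    rw [key f hfK]
    have h3 : ∫⁻ x in K, ‖f x‖ₑ ^ ρ ≤ (C0 * S ^ r) ^ (ρ / r) * volume K ^ (1 - ρ / r) := by
      calc ∫⁻ x in K, ‖f x‖ₑ ^ ρ
          = ∫⁻ x in K, (‖f x‖ₑ ^ r) ^ (ρ / r) * (1 : ℝ≥0∞) ^ (1 - ρ / r) := by
            congr with x
            rw [← ENNReal.rpow_mul, mul_div_cancel₀ _ hr0.ne']; simp
        _ ≤ _ := h2
        _ ≤ _ := by
            gcongr
            · exact (setLIntegral_le_lintegral _ _).trans h1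
            · simp
    calc (∫⁻ x in K, ‖f x‖ₑ ^ ρ) ^ (1 / ρ)
        ≤ ((C0 * S ^ r) ^ (ρ / r) * volume K ^ (1 - ρ / r)) ^ (1 / ρ) := by gcongr
      _ = _ := by
          rw [ENNReal.mul_rpow_of_nonneg _ _ (by positivity : 0 ≤ 1 / ρ), ← ENNReal.rpow_mul,
            ← ENNReal.rpow_mul, ENNReal.mul_rpow_of_nonneg _ _ (by positivity), ← ENNReal.rpow_mul]
          have e1 : ρ / r * (1 / ρ) = 1 / r := by field_simp
          have e2 : r * (1 / r) = 1 := by field_simp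
          rw [e1, e2, ENNReal.rpow_one]
          ring

/-- The power `|f| ^ m` with `1 ≤ m` as a `C^1` function, up to sign when `m = 1`. -/
theorem exists_contDiff_enorm_eq_rpow {d : ℕ} {f : EuclideanSpace ℝ (Fin d) → ℝ}
    (hf : ContDiff ℝ 1 f) (hc : HasCompactSupport f) {m : ℝ} (hm : 1 ≤ m) :
    ∃ g : EuclideanSpace ℝ (Fin d) → ℝ, ContDiff ℝ 1 g ∧ HasCompactSupport g ∧
      (∀ x, ‖g x‖ₑ = ‖f x‖ₑ ^ m) ∧
      ∀ x, ‖fderiv ℝ g x‖ₑ ≤ ENNReal.ofReal m * (‖f x‖ₑ ^ (m - 1) * ‖fderiv ℝ f x‖ₑ) := by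
  rcases hm.eq_or_lt with rfl | hm1
  · exact ⟨f, hf, hc, by simp, by simp⟩
  have hm0 : 0 < m := by linarith
  refine ⟨fun x => ‖f x‖ ^ m, hf.norm_rpow hm1,
    hc.comp_left (g := fun t : ℝ => ‖t‖ ^ m) (by simp [hm0.ne']), fun x => ?_, fun x => ?_⟩
  · rw [Real.enorm_rpow_of_nonneg (norm_nonneg _) hm0.le, enorm_norm]
  · have h2 := enorm_fderiv_norm_rpow_le (hf.differentiable one_ne_zero) (x := x)
      (p := m.toNNReal) (by simpa using hm1)
    rw [Real.coe_toNNReal _ hm0.le] at h2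
    simpa [mul_assoc, ENNReal.ofReal] using h2

/-- The Sobolev inequality applied to a power of a function. -/
theorem exists_lintegral_rpow_mul_le_lintegral_rpow_sub_one_mul_fderiv {d : ℕ} (hd : 1 ≤ d)
    {K : Set (EuclideanSpace ℝ (Fin d))} (hK : volume K ≠ ⊤) {ρ m : ℝ} (hρ : 0 < ρ)
    (hm : 1 ≤ m) (hρd : 1 - 1 / (d : ℝ) ≤ 1 / ρ) :
    ∃ C : ℝ≥0∞, C ≠ ⊤ ∧ ∀ f : EuclideanSpace ℝ (Fin d) → ℝ, ContDiff ℝ 1 f →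
      HasCompactSupport f → (∀ x ∉ K, f x = 0) →
      (∫⁻ x, ‖f x‖ₑ ^ (m * ρ)) ^ (1 / ρ) ≤
        C * ∫⁻ x, ‖f x‖ₑ ^ (m - 1) * ‖fderiv ℝ f x‖ₑ := by
  obtain ⟨C, hC, h⟩ := exists_lintegral_rpow_le_lintegral_fderiv hd hK hρ hρd
  refine ⟨C * ENNReal.ofReal m, ENNReal.mul_ne_top hC ENNReal.ofReal_ne_top, ?_⟩
  intro f hf hc hfK
  obtain ⟨g, hg, hgc, hgf, hgd⟩ := exists_contDiff_enorm_eq_rpow hf hc hm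
  have h1 := h g hg hgc (fun x hx => by
    rw [← enorm_eq_zero, hgf, hfK x hx]; simp; linarith)
  simp_rw [hgf, ← ENNReal.rpow_mul] at h1
  refine h1.trans ?_
  rw [mul_assoc, ← lintegral_const_mul' _ _ ENNReal.ofReal_ne_top]
  gcongr with x
  exact hgd x

/-- This finiteness permits cancelling a power of the left side in `gagliardoNirenberg_of_le`. -/
theorem lintegral_enorm_rpow_ne_top {d : ℕ} {f : EuclideanSpace ℝ (Fin d) → ℝ}
    (hf : Continuous f) (hc : HasCompactSupport f) {r : ℝ} (hr : 0 < r) :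
    ∫⁻ x, ‖f x‖ₑ ^ r ≠ ⊤ := by
  have h1 : Continuous fun x => ‖f x‖ ^ r := hf.norm.rpow_const fun _ => Or.inr hr.le
  have h2 : HasCompactSupport fun x => ‖f x‖ ^ r :=
    hc.comp_left (g := fun t : ℝ => ‖t‖ ^ r) (by simp [hr.ne'])
  have h3 := (h1.integrable_of_hasCompactSupport (μ := volume) h2).hasFiniteIntegral
  rw [HasFiniteIntegral] at h3
  have e : ∀ x, ‖‖f x‖ ^ r‖ₑ = ‖f x‖ₑ ^ r := fun x => by
    rw [Real.enorm_rpow_of_nonneg (norm_nonneg _) hr.le, enorm_norm]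
  simp_rw [e] at h3
  exact h3.ne

/-- Sobolev's inequality for |f|^m bounds ‖f‖_τ^m by the integral of |f|^(m-1)|∇f|. Hölder's
inequality with the three functions |∇f|^p, |f|^τ, |f|^q brings back ‖f‖_τ to the lower power m -
1/a, which is cancelled. The assumption `ha` says that this power is nonnegative. -/
theorem gagliardoNirenberg_of_le {d : ℕ} (hd : 1 ≤ d)
    {K : Set (EuclideanSpace ℝ (Fin d))} (hK : volume K ≠ ⊤) {p q τ a : ℝ}
    (hp : 1 ≤ p) (hq : 1 ≤ q) (hτ : 1 ≤ τ) (ha0 : 0 < a) (ha1 : a ≤ 1)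
    (h : a * (1 / p - 1 / d) + (1 - a) * (1 / q) ≤ 1 / τ)
    (ha : (1 / a - 1) * (1 / q) ≤ 1 - 1 / p) :
    ∃ C : ℝ≥0∞, C ≠ ⊤ ∧ ∀ f : EuclideanSpace ℝ (Fin d) → ℝ, ContDiff ℝ 1 f →
      HasCompactSupport f → (∀ x ∉ K, f x = 0) →
      (∫⁻ x, ‖f x‖ₑ ^ τ) ^ (1 / τ) ≤
        C * (((∫⁻ x, ‖fderiv ℝ f x‖ₑ ^ p) ^ (1 / p)) ^ a *
          ((∫⁻ x, ‖f x‖ₑ ^ q) ^ (1 / q)) ^ (1 - a)) := by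
  have hp0 : 0 < p := by linarith
  have hq0 : 0 < q := by linarith
  have hτ0 : 0 < τ := by linarith
  have h1a : 1 ≤ 1 / a := (one_le_div ha0).2 ha1
  -- Chosen so that the three Hölder weights 1/p, (m - 1/a)/τ and (1/a - 1)/q have sum 1.
  set m : ℝ := (1 - 1 / p - (1 / a - 1) * (1 / q)) * τ + 1 / a with hm
  have hma : 1 / a ≤ m := by
    have : 0 ≤ (1 - 1 / p - (1 / a - 1) * (1 / q)) * τ := mul_nonneg (by linarith) hτ0.le
    linarith
  have hm1 : 1 ≤ m := h1a.trans hma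
  have hm0 : 0 < m := by linarith
  have hρ : 1 / (τ / m) = m / τ := by field_simp
  have hρd : 1 - 1 / (d : ℝ) ≤ 1 / (τ / m) := by
    have e1 : m / τ = (1 - 1 / p - (1 / a - 1) * (1 / q)) + (1 / a) * (1 / τ) := by
      rw [hm]; field_simp
    have e2 : (1 / a) * (a * (1 / p - 1 / d) + (1 - a) * (1 / q)) ≤ (1 / a) * (1 / τ) := by
      gcongr
    have e3 : (1 / a) * (a * (1 / p - 1 / d) + (1 - a) * (1 / q))
      = 1 / p - 1 / d + (1 / a - 1) * (1 / q) := by field_simp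
    rw [hρ, e1]
    linarith
  obtain ⟨C, hC, hS⟩ := exists_lintegral_rpow_mul_le_lintegral_rpow_sub_one_mul_fderiv hd hK
    (div_pos hτ0 hm0) hm1 hρd
  refine ⟨C ^ a, ENNReal.rpow_ne_top_of_nonneg ha0.le hC, ?_⟩
  intro f hf hc hfK
  have h1 := hS f hf hc hfK
  have hmf : Measurable fun x => ‖f x‖ₑ := hf.continuous.measurable.enorm
  have hmg : Measurable fun x => ‖fderiv ℝ f x‖ₑ :=
    (hf.continuous_fderiv one_ne_zero).measurable.enorm
  set X := ∫⁻ x, ‖f x‖ₑ ^ τ with hX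
  set Y := ∫⁻ x, ‖f x‖ₑ ^ q
  set G := ∫⁻ x, ‖fderiv ℝ f x‖ₑ ^ p
  have hXt : X ≠ ⊤ := lintegral_enorm_rpow_ne_top hf.continuous hc hτ0
  rw [mul_div_cancel₀ _ hm0.ne', hρ] at h1
  have hy : 0 ≤ (m - 1 / a) / τ := div_nonneg (by linarith) hτ0.le
  have hz : 0 ≤ (1 / a - 1) / q := div_nonneg (by linarith) hq0.le
  have h2 : ∫⁻ x, ‖f x‖ₑ ^ (m - 1) * ‖fderiv ℝ f x‖ₑ ≤
      G ^ (1 / p) * (X ^ ((m - 1 / a) / τ) * Y ^ ((1 / a - 1) / q)) := by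
    refine le_trans (le_of_eq ?_) (lintegral_rpow_mul_rpow_mul_rpow_le (hmg.pow_const p).aemeasurable
      (hmf.pow_const τ).aemeasurable (hmf.pow_const q).aemeasurable (by positivity) hy hz ?_)
    · congr with x
      rw [← ENNReal.rpow_mul, ← ENNReal.rpow_mul, ← ENNReal.rpow_mul, mul_one_div_cancel hp0.ne',
        mul_div_cancel₀ _ hτ0.ne', mul_div_cancel₀ _ hq0.ne', ENNReal.rpow_one,
        ← ENNReal.rpow_add_of_nonneg _ _ (by linarith) (by linarith), mul_comm]
      ring_nf
    · rw [hm]; field_simp; ring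
  by_cases hX0 : X = 0
  · rw [hX0, ENNReal.zero_rpow_of_pos (by positivity)]; exact zero_le
  have h3 : X ^ (1 / a / τ) ≤ C * (G ^ (1 / p) * Y ^ ((1 / a - 1) / q)) := by
    have h4 : X ^ (1 / a / τ) * X ^ ((m - 1 / a) / τ) ≤
        C * (G ^ (1 / p) * Y ^ ((1 / a - 1) / q)) * X ^ ((m - 1 / a) / τ) := by
      calc X ^ (1 / a / τ) * X ^ ((m - 1 / a) / τ) = X ^ (m / τ) := by
            rw [← ENNReal.rpow_add_of_nonneg _ _ (by positivity) hy]; ring_nf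
        _ ≤ C * (G ^ (1 / p) * (X ^ ((m - 1 / a) / τ) * Y ^ ((1 / a - 1) / q))) :=
            h1.trans (by gcongr)
        _ = _ := by ring
    refine (ENNReal.mul_le_mul_iff_left ?_ ?_).1 h4
    · exact (ENNReal.rpow_pos (pos_iff_ne_zero.2 hX0) hXt).ne'
    · exact ENNReal.rpow_ne_top_of_nonneg hy hXt
  calc X ^ (1 / τ) = (X ^ (1 / a / τ)) ^ a := by
        rw [← ENNReal.rpow_mul]; congr 1; field_simp
    _ ≤ (C * (G ^ (1 / p) * Y ^ ((1 / a - 1) / q))) ^ a := by gcongr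
    _ = _ := by
        rw [ENNReal.mul_rpow_of_nonneg _ _ ha0.le, ENNReal.mul_rpow_of_nonneg _ _ ha0.le]
        congr 2
        rw [← ENNReal.rpow_mul, ← ENNReal.rpow_mul]; congr 1; field_simp

/-- Here the power of ‖f‖_τ in the previous argument would be negative. Instead m is taken so that
|f|^(m-1)|∇f| is controlled by the L^p norm of ∇f and the L^q norm of f alone, and L^τ is
interpolated between L^q and the space L^(1/y) given by Sobolev's inequality for |f|^m. -/
theorem gagliardoNirenberg_of_lt {d : ℕ} (hd : 1 ≤ d)
    {K : Set (EuclideanSpace ℝ (Fin d))} (hK : volume K ≠ ⊤) {p q τ a : ℝ}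
    (hp : 1 ≤ p) (hq : 1 ≤ q) (hτ : 1 ≤ τ) (ha0 : 0 < a)
    (h : a * (1 / p - 1 / d) + (1 - a) * (1 / q) ≤ 1 / τ)
    (ha : 1 - 1 / p < (1 / a - 1) * (1 / q)) :
    ∃ C : ℝ≥0∞, C ≠ ⊤ ∧ ∀ f : EuclideanSpace ℝ (Fin d) → ℝ, ContDiff ℝ 1 f →
      HasCompactSupport f → (∀ x ∉ K, f x = 0) →
      (∫⁻ x, ‖f x‖ₑ ^ τ) ^ (1 / τ) ≤
        C * (((∫⁻ x, ‖fderiv ℝ f x‖ₑ ^ p) ^ (1 / p)) ^ a *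
          ((∫⁻ x, ‖f x‖ₑ ^ q) ^ (1 / q)) ^ (1 - a)) := by
  have hp0 : 0 < p := by linarith
  have hq0 : 0 < q := by linarith
  have hτ0 : 0 < τ := by linarith
  have hd0 : (0 : ℝ) < d := by exact_mod_cast hd
  have hp1 : 0 ≤ 1 - 1 / p := by
    have := (div_le_one hp0).2 hp
    linarith
  have hd1 : 0 ≤ 1 - 1 / (d : ℝ) := by
    have := (div_le_one hd0).2 (by exact_mod_cast hd : (1 : ℝ) ≤ d)
    linarith
  -- With m - 1 = q(1 - 1/p), Hölder's inequality with weights 1/p and 1 - 1/p produces exactly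
  -- |∇f|^p and |f|^q. The assumption `ha` amounts to am < 1, so am is an interpolation parameter.
  set m : ℝ := 1 + q * (1 - 1 / p) with hm
  have hm1 : 1 ≤ m := by
    have : 0 ≤ q * (1 - 1 / p) := by positivity
    linarith
  have hm0 : 0 < m := by linarith
  have hb1 : a * m < 1 := by
    have h1 := mul_lt_mul_of_pos_left ha (mul_pos ha0 hq0)
    have h2 : a * q * ((1 / a - 1) * (1 / q)) = 1 - a := by field_simp
    rw [hm]; nlinarith
  have hb0 : 0 < a * m := by positivity
  -- The reciprocal of the other interpolation exponent: 1/τ = am·y + (1 - am)/q.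
  set y : ℝ := (1 / τ - (1 - a * m) / q) / (a * m) with hy
  have hyd : 1 - 1 / (d : ℝ) ≤ m * y := by
    have e1 : m * y = (1 / a) * (1 / τ) - (1 - a * m) / (q * a) := by rw [hy]; field_simp
    have e2 : (1 / a) * (a * (1 / p - 1 / d) + (1 - a) * (1 / q)) ≤ (1 / a) * (1 / τ) := by
      gcongr
    have e3 : (1 / a) * (a * (1 / p - 1 / d) + (1 - a) * (1 / q)) - (1 - a * m) / (q * a)
      = 1 - 1 / d := by rw [hm]; field_simp; ring
    rw [e1]
    linarith
  have hy0 : 0 ≤ y := by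
    have : 0 ≤ m * y := hd1.trans hyd
    exact nonneg_of_mul_nonneg_right this hm0
  have hsum : a * m * y + (1 - a * m) / q = 1 / τ := by rw [hy]; field_simp; ring
  -- it suffices to bound the norm by a power of `∫ |f| ^ (m - 1) |∇ f|`
  suffices hmain : ∃ C : ℝ≥0∞, C ≠ ⊤ ∧ ∀ f : EuclideanSpace ℝ (Fin d) → ℝ, ContDiff ℝ 1 f →
      HasCompactSupport f → (∀ x ∉ K, f x = 0) →
      (∫⁻ x, ‖f x‖ₑ ^ τ) ^ (1 / τ) ≤
        (C * ∫⁻ x, ‖f x‖ₑ ^ (m - 1) * ‖fderiv ℝ f x‖ₑ) ^ a *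
          (∫⁻ x, ‖f x‖ₑ ^ q) ^ ((1 - a * m) / q) by
    obtain ⟨C, hC, hS⟩ := hmain
    refine ⟨C ^ a, ENNReal.rpow_ne_top_of_nonneg ha0.le hC, ?_⟩
    intro f hf hc hfK
    refine (hS f hf hc hfK).trans ?_
    have hmf : Measurable fun x => ‖f x‖ₑ := hf.continuous.measurable.enorm
    have hmg : Measurable fun x => ‖fderiv ℝ f x‖ₑ :=
      (hf.continuous_fderiv one_ne_zero).measurable.enorm
    set Y := ∫⁻ x, ‖f x‖ₑ ^ q
    set G := ∫⁻ x, ‖fderiv ℝ f x‖ₑ ^ p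
    have h2 : ∫⁻ x, ‖f x‖ₑ ^ (m - 1) * ‖fderiv ℝ f x‖ₑ ≤ G ^ (1 / p) * Y ^ (1 - 1 / p) := by
      refine le_trans (le_of_eq ?_) (ENNReal.lintegral_mul_norm_pow_le (hmg.pow_const p).aemeasurable
        (hmf.pow_const q).aemeasurable (by positivity) hp1 (by ring))
      congr with x
      rw [← ENNReal.rpow_mul, ← ENNReal.rpow_mul, mul_one_div_cancel hp0.ne', ENNReal.rpow_one,
        mul_comm, hm]
      ring_nf
    calc (C * ∫⁻ x, ‖f x‖ₑ ^ (m - 1) * ‖fderiv ℝ f x‖ₑ) ^ a * Y ^ ((1 - a * m) / q)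
        ≤ (C * (G ^ (1 / p) * Y ^ (1 - 1 / p))) ^ a * Y ^ ((1 - a * m) / q) := by gcongr
      _ = C ^ a * ((G ^ (1 / p)) ^ a * (Y ^ (1 / q)) ^ (1 - a)) := by
        rw [ENNReal.mul_rpow_of_nonneg _ _ ha0.le, ENNReal.mul_rpow_of_nonneg _ _ ha0.le, mul_assoc,
          mul_assoc, ← ENNReal.rpow_mul Y, ← ENNReal.rpow_mul Y, ← ENNReal.rpow_add_of_nonneg _ _
          (by positivity) (div_nonneg (by linarith) hq0.le)]
        congr 3
        rw [hm]; field_simp; ring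
  rcases hy0.eq_or_lt with hy0 | hy0
  -- The value y = 0 stands for L^∞. The bound 1 - 1/d ≤ my then forces d = 1, where the supremum
  -- bound is available.
  · have hd' : d = 1 := by
      rw [← hy0, mul_zero] at hyd
      have : (d : ℝ) ≤ 1 := by
        have := (one_le_div hd0).1 (by linarith : 1 ≤ 1 / (d : ℝ))
        exact this
      exact le_antisymm (by exact_mod_cast this) hd
    subst hd'
    refine ⟨ENNReal.ofReal m, ENNReal.ofReal_ne_top, ?_⟩
    intro f hf hc hfK
    obtain ⟨g, hg, hgc, hgf, hgd⟩ := exists_contDiff_enorm_eq_rpow hf hc hm1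
    set S := ENNReal.ofReal m * ∫⁻ x, ‖f x‖ₑ ^ (m - 1) * ‖fderiv ℝ f x‖ₑ with hS
    have h1 : ∀ x, ‖f x‖ₑ ^ m ≤ S := by
      intro x
      rw [← hgf, hS, ← lintegral_const_mul' _ _ ENNReal.ofReal_ne_top]
      exact (enorm_le_lintegral_enorm_fderiv hg hgc x).trans (lintegral_mono hgd)
    rw [← hy0, mul_zero, zero_add] at hsum
    have hqτ : τ * a * m + q = τ := by
      have : (1 - a * m) * τ = q := by field_simp at hsum; linarith
      linarith
    have hmf : Measurable fun x => ‖f x‖ₑ := hf.continuous.measurable.enorm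
    calc (∫⁻ x, ‖f x‖ₑ ^ τ) ^ (1 / τ) ≤ (∫⁻ x, S ^ (τ * a) * ‖f x‖ₑ ^ q) ^ (1 / τ) := by
          gcongr with x
          calc ‖f x‖ₑ ^ τ = (‖f x‖ₑ ^ m) ^ (τ * a) * ‖f x‖ₑ ^ q := by
                rw [← ENNReal.rpow_mul, ← ENNReal.rpow_add_of_nonneg _ _ (by positivity) hq0.le]
                congr 1; linarith
            _ ≤ _ := by gcongr; exact h1 x
      _ = _ := by
        rw [lintegral_const_mul _ (hmf.pow_const q), ENNReal.mul_rpow_of_nonneg _ _ (by positivity),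
          ← ENNReal.rpow_mul, hsum]
        congr 2; field_simp
  · have hρ : 1 / (1 / (m * y)) = m * y := by field_simp
    obtain ⟨C, hC, hS⟩ := exists_lintegral_rpow_mul_le_lintegral_rpow_sub_one_mul_fderiv hd hK
      (ρ := 1 / (m * y)) (by positivity) hm1 (by rwa [hρ])
    refine ⟨C, hC, ?_⟩
    intro f hf hc hfK
    have h1 := hS f hf hc hfK
    rw [hρ, show m * (1 / (m * y)) = 1 / y by field_simp] at h1
    have hmf : Measurable fun x => ‖f x‖ₑ := hf.continuous.measurable.enorm
    set T := ∫⁻ x, ‖f x‖ₑ ^ (1 / y)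
    have e1 : τ * (a * m * y) + τ * ((1 - a * m) / q) = 1 := by
      rw [← mul_add, hsum]; field_simp
    have e2 : 0 ≤ τ * ((1 - a * m) / q) := mul_nonneg hτ0.le (div_nonneg (by linarith) hq0.le)
    have h2 := ENNReal.lintegral_mul_norm_pow_le (μ := volume) (hmf.pow_const (1 / y)).aemeasurable
      (hmf.pow_const q).aemeasurable (by positivity) e2 e1
    have e3 : ∀ x, (‖f x‖ₑ ^ (1 / y)) ^ (τ * (a * m * y)) *
        (‖f x‖ₑ ^ q) ^ (τ * ((1 - a * m) / q)) = ‖f x‖ₑ ^ τ := by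
      intro x
      rw [← ENNReal.rpow_mul, ← ENNReal.rpow_mul, ← ENNReal.rpow_add_of_nonneg _ _ (by positivity)
        (mul_nonneg hq0.le e2)]
      congr 1; field_simp; ring
    simp_rw [e3] at h2
    calc _ ≤ _ := ENNReal.rpow_le_rpow h2 (by positivity : 0 ≤ 1 / τ)
      _ = (T ^ (m * y)) ^ a * (∫⁻ x, ‖f x‖ₑ ^ q) ^ ((1 - a * m) / q) := by
        rw [ENNReal.mul_rpow_of_nonneg _ _ (by positivity), ← ENNReal.rpow_mul, ← ENNReal.rpow_mul,
          ← ENNReal.rpow_mul]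
        congr 2 <;> field_simp
      _ ≤ _ := by gcongr

/-- The Gagliardo–Nirenberg inequality for functions supported in a set of finite measure, for all
subcritical exponents. -/
theorem gagliardoNirenberg {d : ℕ} (hd : 1 ≤ d)
    {K : Set (EuclideanSpace ℝ (Fin d))} (hK : volume K ≠ ⊤) {p q τ a : ℝ}
    (hp : 1 ≤ p) (hq : 1 ≤ q) (hτ : 1 ≤ τ) (ha0 : 0 < a) (ha1 : a ≤ 1)
    (h : a * (1 / p - 1 / d) + (1 - a) * (1 / q) ≤ 1 / τ) :
    ∃ C : ℝ≥0∞, C ≠ ⊤ ∧ ∀ f : EuclideanSpace ℝ (Fin d) → ℝ, ContDiff ℝ 1 f →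
      HasCompactSupport f → (∀ x ∉ K, f x = 0) →
      (∫⁻ x, ‖f x‖ₑ ^ τ) ^ (1 / τ) ≤
        C * (((∫⁻ x, ‖fderiv ℝ f x‖ₑ ^ p) ^ (1 / p)) ^ a *
          ((∫⁻ x, ‖f x‖ₑ ^ q) ^ (1 / q)) ^ (1 - a)) := by
  rcases le_or_gt ((1 / a - 1) * (1 / q)) (1 - 1 / p) with h1 | h1
  · exact gagliardoNirenberg_of_le hd hK hp hq hτ ha0 ha1 h h1
  · exact gagliardoNirenberg_of_lt hd hK hp hq hτ ha0 h h1

/-! ### Annuli and dilations -/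

/-- The closed annulus `{r ≤ ‖x‖ ≤ R}`. -/
def closedAnnulus (d : ℕ) (r R : ℝ) : Set (EuclideanSpace ℝ (Fin d)) := {x | r ≤ ‖x‖ ∧ ‖x‖ ≤ R}

theorem isClosed_closedAnnulus {d : ℕ} (r R : ℝ) : IsClosed (closedAnnulus d r R) :=
  (isClosed_le continuous_const continuous_norm).inter
    (isClosed_le continuous_norm continuous_const)

theorem isCompact_closedAnnulus {d : ℕ} (r R : ℝ) : IsCompact (closedAnnulus d r R) :=
  (isCompact_closedBall (0 : EuclideanSpace ℝ (Fin d)) R).of_isClosed_subset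
    (isClosed_closedAnnulus r R) fun x hx => by simpa using hx.2

theorem closedAnnulus_subset {d : ℕ} {r R r' R' : ℝ} (hr : r' ≤ r) (hR : R ≤ R') :
    closedAnnulus d r R ⊆ closedAnnulus d r' R' := fun _ hx => ⟨hr.trans hx.1, hx.2.trans hR⟩

theorem preimage_smul_closedAnnulus {d : ℕ} {t : ℝ} (ht : 0 < t) (r R : ℝ) :
    (fun x => t • x) ⁻¹' closedAnnulus d (t * r) (t * R) = closedAnnulus d r R := by
  ext x
  simp [closedAnnulus, norm_smul, abs_of_pos ht, ht]

theorem closedAnnulus_subset_compl_zero {d : ℕ} {r R : ℝ} (hr : 0 < r) :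
    closedAnnulus d r R ⊆ {0}ᶜ := by
  intro x hx h0
  rw [Set.mem_singleton_iff] at h0
  have := hx.1
  rw [h0, norm_zero] at this
  linarith

theorem lintegral_comp_smul {d : ℕ} {t : ℝ} (ht : 0 < t) (F : EuclideanSpace ℝ (Fin d) → ℝ≥0∞) :
    ∫⁻ x, F (t • x) = ENNReal.ofReal ((t ^ d)⁻¹) * ∫⁻ x, F x := by
  have h1 := Measure.map_addHaar_smul (volume : Measure (EuclideanSpace ℝ (Fin d))) ht.ne'
  have h2 : ∫⁻ x, F (t • x) = ∫⁻ x, F x ∂(Measure.map (fun x => t • x) volume) :=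
    (lintegral_map_equiv F
      (Homeomorph.smul (isUnit_iff_ne_zero.2 ht.ne').unit).toMeasurableEquiv).symm
  rw [h2]
  change ∫⁻ x, F x ∂(Measure.map (t • ·) volume) = _
  rw [h1, lintegral_smul_measure, smul_eq_mul, finrank_euclideanSpace, Fintype.card_fin,
    abs_of_pos (by positivity)]

theorem setLIntegral_comp_smul {d : ℕ} {t : ℝ} (ht : 0 < t) {T : Set (EuclideanSpace ℝ (Fin d))}
    (hT : MeasurableSet T) (F : EuclideanSpace ℝ (Fin d) → ℝ≥0∞) :
    ∫⁻ x in (fun x => t • x) ⁻¹' T, F (t • x) =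
      ENNReal.ofReal ((t ^ d)⁻¹) * ∫⁻ x in T, F x := by
  rw [← lintegral_indicator hT, ← lintegral_comp_smul ht,
    ← lintegral_indicator (hT.preimage (measurable_const_smul t))]
  rfl

/-- Annuli may be enlarged when a function is composed with an expansion. -/
theorem setLIntegral_closedAnnulus_comp_smul_le {d : ℕ} {t r R r' R' : ℝ} (ht : 1 ≤ t)
    (hr : r' ≤ t * r) (hR : t * R ≤ R') (F : EuclideanSpace ℝ (Fin d) → ℝ≥0∞) :
    ∫⁻ x in closedAnnulus d r R, F (t • x) ≤ ∫⁻ x in closedAnnulus d r' R', F x := by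
  have ht0 : 0 < t := by linarith
  rw [← preimage_smul_closedAnnulus ht0,
    setLIntegral_comp_smul ht0 (isClosed_closedAnnulus _ _).measurableSet]
  calc _ ≤ 1 * ∫⁻ x in closedAnnulus d (t * r) (t * R), F x := by
        gcongr
        rw [ENNReal.ofReal_le_one]
        exact inv_le_one_of_one_le₀ (one_le_pow₀ ht)
    _ ≤ _ := by
        rw [one_mul]
        exact lintegral_mono_set (closedAnnulus_subset hr hR)

/-! ### The dyadic increment of a C^1 function on an annulus -/

/-- Jensen's inequality for powers, with a weight of mass at most one. -/
theorem lintegral_mul_rpow_le {α : Type*} [MeasurableSpace α] {μ : Measure α} {φ f : α → ℝ≥0∞}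
    (hφ : AEMeasurable φ μ) (hf : AEMeasurable f μ) (hφ1 : ∫⁻ x, φ x ∂μ ≤ 1) {p : ℝ}
    (hp : 1 ≤ p) : (∫⁻ x, φ x * f x ∂μ) ^ p ≤ ∫⁻ x, φ x * f x ^ p ∂μ := by
  have hp0 : 0 < p := by linarith
  have hp1 : 0 ≤ 1 - 1 / p := by
    have := (div_le_one hp0).2 hp
    linarith
  have h1 := ENNReal.lintegral_mul_norm_pow_le (hφ.mul (hf.pow_const p)) hφ
    (by positivity : 0 ≤ 1 / p) hp1 (by ring)
  have e : ∀ x, (φ x * f x ^ p) ^ (1 / p) * φ x ^ (1 - 1 / p) = φ x * f x := by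
    intro x
    rw [ENNReal.mul_rpow_of_nonneg _ _ (by positivity), ← ENNReal.rpow_mul,
      mul_one_div_cancel hp0.ne', ENNReal.rpow_one, mul_right_comm,
      ← ENNReal.rpow_add_of_nonneg _ _ (by positivity) hp1]
    simp
  simp only [Pi.mul_apply, e] at h1
  calc (∫⁻ x, φ x * f x ∂μ) ^ p
      ≤ ((∫⁻ x, φ x * f x ^ p ∂μ) ^ (1 / p) * 1 ^ (1 - 1 / p)) ^ p := by
        gcongr
        exact h1.trans (by gcongr)
    _ = _ := by
        rw [ENNReal.one_rpow, mul_one, ← ENNReal.rpow_mul, one_div_mul_cancel hp0.ne',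
          ENNReal.rpow_one]

/-- The fundamental theorem of calculus along the segment from x to 2x. -/
theorem enorm_sub_le_lintegral_fderiv {d : ℕ} {w : EuclideanSpace ℝ (Fin d) → ℝ}
    (hw : ContDiff ℝ 1 w) (x : EuclideanSpace ℝ (Fin d)) :
    ‖w ((2 : ℝ) • x) - w x‖ₑ ≤
      ‖x‖ₑ * ∫⁻ t in Set.Ioc (1 : ℝ) 2, ‖fderiv ℝ w (t • x)‖ₑ := by
  have h1 : ∀ t : ℝ, HasDerivAt (fun t : ℝ => w (t • x)) (fderiv ℝ w (t • x) x) t := by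
    intro t
    have h2 : HasDerivAt (fun t : ℝ => t • x) x t := by
      simpa using (hasDerivAt_id t).smul_const x
    exact ((hw.differentiable one_ne_zero (t • x)).hasFDerivAt).comp_hasDerivAt t h2
  have hcont : Continuous fun t : ℝ => fderiv ℝ w (t • x) x :=
    ((hw.continuous_fderiv one_ne_zero).comp (continuous_id.smul continuous_const)).clm_apply
      continuous_const
  have h3 := intervalIntegral.integral_eq_sub_of_hasDerivAt (a := 1) (b := 2)
    (fun t _ => h1 t) (hcont.intervalIntegrable _ _)
  simp only [one_smul] at h3
  rw [← h3, intervalIntegral.integral_of_le (by norm_num)]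
  refine (enorm_integral_le_lintegral_enorm _).trans ?_
  rw [← lintegral_const_mul' _ _ enorm_ne_top]
  gcongr with t
  rw [mul_comm]
  exact ContinuousLinearMap.le_opENorm _ _

/-- Substitute for Poincaré's inequality: the increment is bounded by the gradient alone. Jensen's
inequality in t and Tonelli reduce it to the dilations x ↦ tx with 1 < t ≤ 2, which do not increase
integrals and map the annulus into the larger one; the factor 4 bounds ‖x‖. -/
theorem lintegral_closedAnnulus_sub_rpow_le {d : ℕ} {w : EuclideanSpace ℝ (Fin d) → ℝ}
    (hw : ContDiff ℝ 1 w) {p : ℝ} (hp : 1 ≤ p) :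
    ∫⁻ x in closedAnnulus d (1 / 2) 4, ‖w ((2 : ℝ) • x) - w x‖ₑ ^ p ≤
      4 ^ p * ∫⁻ x in closedAnnulus d (1 / 2) 8, ‖fderiv ℝ w x‖ₑ ^ p := by
  have hp0 : 0 < p := by linarith
  have hcont : Continuous fun z : EuclideanSpace ℝ (Fin d) × ℝ => fderiv ℝ w (z.2 • z.1) :=
    (hw.continuous_fderiv one_ne_zero).comp (continuous_snd.smul continuous_fst)
  have hmeas : Measurable fun z : EuclideanSpace ℝ (Fin d) × ℝ =>
      ‖fderiv ℝ w (z.2 • z.1)‖ₑ ^ p := hcont.measurable.enorm.pow_const p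
  have h1 : ∀ x ∈ closedAnnulus d (1 / 2) 4, ‖w ((2 : ℝ) • x) - w x‖ₑ ^ p ≤
      4 ^ p * ∫⁻ t in Set.Ioc (1 : ℝ) 2, ‖fderiv ℝ w (t • x)‖ₑ ^ p := by
    intro x hx
    have hx4 : ‖x‖ₑ ≤ 4 := by
      rw [← ofReal_norm]
      exact (ENNReal.ofReal_le_ofReal hx.2).trans (by simp)
    have hm : Measurable fun t : ℝ => ‖fderiv ℝ w (t • x)‖ₑ :=
      ((hw.continuous_fderiv one_ne_zero).comp
        (continuous_id.smul continuous_const)).measurable.enorm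
    have h2 := lintegral_mul_rpow_le (μ := volume.restrict (Set.Ioc (1 : ℝ) 2))
      (aemeasurable_const (b := (1 : ℝ≥0∞))) hm.aemeasurable
      (by simp; norm_num) hp
    simp only [one_mul] at h2
    calc _ ≤ (4 * ∫⁻ t in Set.Ioc (1 : ℝ) 2, ‖fderiv ℝ w (t • x)‖ₑ) ^ p := by
          gcongr
          exact (enorm_sub_le_lintegral_fderiv hw x).trans (by gcongr)
      _ ≤ _ := by
          rw [ENNReal.mul_rpow_of_nonneg _ _ hp0.le]
          gcongr
  calc _ ≤ ∫⁻ x in closedAnnulus d (1 / 2) 4,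
        4 ^ p * ∫⁻ t in Set.Ioc (1 : ℝ) 2, ‖fderiv ℝ w (t • x)‖ₑ ^ p :=
        setLIntegral_mono' (isClosed_closedAnnulus _ _).measurableSet h1
    _ = 4 ^ p * ∫⁻ t in Set.Ioc (1 : ℝ) 2, ∫⁻ x in closedAnnulus d (1 / 2) 4,
        ‖fderiv ℝ w (t • x)‖ₑ ^ p := by
        rw [lintegral_const_mul' _ _ (ENNReal.rpow_ne_top_of_nonneg hp0.le (by simp)),
          lintegral_lintegral_swap hmeas.aemeasurable]
    _ ≤ 4 ^ p * ∫⁻ t in Set.Ioc (1 : ℝ) 2, ∫⁻ x in closedAnnulus d (1 / 2) 8,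
        ‖fderiv ℝ w x‖ₑ ^ p := by
        gcongr 4 ^ p * ?_
        refine setLIntegral_mono' measurableSet_Ioc fun t ht => ?_
        exact setLIntegral_closedAnnulus_comp_smul_le ht.1.le (by linarith [ht.1])
          (by linarith [ht.2]) (fun y => ‖fderiv ℝ w y‖ₑ ^ p)
    _ = _ := by
        rw [setLIntegral_const, Real.volume_Ioc]
        norm_num

/-- The transitions are functions of ‖x‖², which is smooth at the origin too. The first rises
between radii 1/2 and 1, the second falls between radii 2 and 4. -/
theorem exists_contDiff_cutoff_closedAnnulus (d : ℕ) :
    ∃ χ : EuclideanSpace ℝ (Fin d) → ℝ, ContDiff ℝ 1 χ ∧ HasCompactSupport χ ∧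
      (∀ x, ‖χ x‖ ≤ 1) ∧ (∀ x ∈ closedAnnulus d 1 2, χ x = 1) ∧
      (∀ x ∉ closedAnnulus d (1 / 2) 4, χ x = 0) := by
  have h0 : ∀ x ∉ closedAnnulus d (1 / 2) 4, Real.smoothTransition ((4 * ‖x‖ ^ 2 - 1) / 3) *
      Real.smoothTransition ((16 - ‖x‖ ^ 2) / 12) = 0 := by
    intro x hx
    rw [closedAnnulus, Set.mem_ofPred_eq, not_and_or, not_le, not_le] at hx
    rcases hx with hx | hx
    · rw [Real.smoothTransition.zero_of_nonpos, zero_mul]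
      nlinarith [norm_nonneg x]
    · rw [mul_eq_zero]
      right
      apply Real.smoothTransition.zero_of_nonpos
      nlinarith [norm_nonneg x]
  refine ⟨fun x => Real.smoothTransition ((4 * ‖x‖ ^ 2 - 1) / 3) *
    Real.smoothTransition ((16 - ‖x‖ ^ 2) / 12), ?_, ?_, ?_, ?_, h0⟩
  · have hn : ContDiff ℝ 1 fun x : EuclideanSpace ℝ (Fin d) => ‖x‖ ^ 2 := contDiff_norm_sq ℝ
    exact (Real.smoothTransition.contDiff.comp (by fun_prop)).mul
      (Real.smoothTransition.contDiff.comp (by fun_prop))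
  · exact HasCompactSupport.intro (isCompact_closedAnnulus (1 / 2) 4) h0
  · intro x
    rw [norm_mul, Real.norm_of_nonneg (Real.smoothTransition.nonneg _),
      Real.norm_of_nonneg (Real.smoothTransition.nonneg _)]
    exact mul_le_one₀ (Real.smoothTransition.le_one _) (Real.smoothTransition.nonneg _)
      (Real.smoothTransition.le_one _)
  · intro x hx
    have h1 := hx.1
    have h2 := hx.2
    dsimp only
    rw [Real.smoothTransition.one_of_one_le, Real.smoothTransition.one_of_one_le, mul_one]
    all_goals nlinarith [norm_nonneg x]

/-- The dyadic increment of a `C^1` function satisfies a Gagliardo–Nirenberg inequality on an annulus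
without lower order terms. -/
theorem exists_closedAnnulus_sub_le_of_contDiff {d : ℕ} (hd : 1 ≤ d) {p q τ a : ℝ}
    (hp : 1 ≤ p) (hq : 1 ≤ q) (hτ : 1 ≤ τ) (ha0 : 0 < a) (ha1 : a ≤ 1)
    (h : a * (1 / p - 1 / d) + (1 - a) * (1 / q) ≤ 1 / τ) :
    ∃ C : ℝ≥0∞, C ≠ ⊤ ∧ ∀ w : EuclideanSpace ℝ (Fin d) → ℝ, ContDiff ℝ 1 w →
      (∫⁻ x in closedAnnulus d 1 2, ‖w ((2 : ℝ) • x) - w x‖ₑ ^ τ) ^ (1 / τ) ≤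
        C * (((∫⁻ x in closedAnnulus d (1 / 2) 8, ‖fderiv ℝ w x‖ₑ ^ p) ^ (1 / p)) ^ a *
          ((∫⁻ x in closedAnnulus d (1 / 2) 8, ‖w x‖ₑ ^ q) ^ (1 / q)) ^ (1 - a)) := by
  have hp0 : 0 < p := by linarith
  have hq0 : 0 < q := by linarith
  have hτ0 : 0 < τ := by linarith
  obtain ⟨C, hC, hGN⟩ := gagliardoNirenberg hd
    (isCompact_closedAnnulus (d := d) (1 / 2) 4).measure_lt_top.ne hp hq hτ ha0 ha1 h
  obtain ⟨χ, hχ, hχc, hχ1, hχone, hχ0⟩ := exists_contDiff_cutoff_closedAnnulus d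
  obtain ⟨L, hL⟩ := (hχ.continuous_fderiv one_ne_zero).bounded_above_of_compact_support
    (hχc.fderiv (𝕜 := ℝ))
  -- L bounds ∇χ and 4 comes from the increment estimate; 3 = 2 + 1 comes from differentiating w(2x)
  -- and w(x). The last 2 counts the two terms of the increment in L^q.
  refine ⟨C * ((ENNReal.ofReal L * 4 + 3) ^ a * 2 ^ (1 - a)), ?_, ?_⟩
  · refine ENNReal.mul_ne_top hC (ENNReal.mul_ne_top ?_ ?_)
    · refine ENNReal.rpow_ne_top_of_nonneg ha0.le ?_
      exact ENNReal.add_ne_top.2 ⟨ENNReal.mul_ne_top ENNReal.ofReal_ne_top (by simp), by simp⟩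
    · exact ENNReal.rpow_ne_top_of_nonneg (by linarith) (by simp)
  intro w hw
  set K := closedAnnulus d (1 / 2) 4 with hK
  have hKm : MeasurableSet K := (isClosed_closedAnnulus _ _).measurableSet
  set P := (∫⁻ x in closedAnnulus d (1 / 2) 8, ‖fderiv ℝ w x‖ₑ ^ p) ^ (1 / p) with hP
  set Q := (∫⁻ x in closedAnnulus d (1 / 2) 8, ‖w x‖ₑ ^ q) ^ (1 / q) with hQ
  set z : EuclideanSpace ℝ (Fin d) → ℝ := fun x => w ((2 : ℝ) • x) - w x with hz
  have hw2 : ContDiff ℝ 1 fun x : EuclideanSpace ℝ (Fin d) => w ((2 : ℝ) • x) :=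
    hw.comp (contDiff_const_smul (2 : ℝ))
  have hzC : ContDiff ℝ 1 z := hw2.sub hw
  have hfC : ContDiff ℝ 1 fun x => χ x * z x := hχ.mul hzC
  have hf0 : ∀ x ∉ K, χ x * z x = 0 := fun x hx => by rw [hχ0 x hx, zero_mul]
  have h1 := hGN (fun x => χ x * z x) hfC (HasCompactSupport.intro
    (isCompact_closedAnnulus (d := d) (1 / 2) 4) hf0) hf0
  have hw' : Continuous (fderiv ℝ w) := hw.continuous_fderiv one_ne_zero
  have hw'2 : Continuous fun x : EuclideanSpace ℝ (Fin d) => fderiv ℝ w ((2 : ℝ) • x) :=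
    hw'.comp (continuous_const_smul (2 : ℝ))
  have hχe : ∀ x, ‖χ x‖ₑ ≤ 1 := fun x => by
    rw [← ofReal_norm, ENNReal.ofReal_le_one]; exact hχ1 x
  -- left-hand side
  have hleft : (∫⁻ x in closedAnnulus d 1 2, ‖z x‖ₑ ^ τ) ^ (1 / τ) ≤
      (∫⁻ x, ‖χ x * z x‖ₑ ^ τ) ^ (1 / τ) := by
    refine ENNReal.rpow_le_rpow ?_ (by positivity)
    refine le_trans (le_of_eq ?_) (setLIntegral_le_lintegral (closedAnnulus d 1 2) _)
    refine setLIntegral_congr_fun (isClosed_closedAnnulus _ _).measurableSet fun x hx => ?_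
    simp [hχone x hx]
  -- the function
  have hQ2 : (∫⁻ x, ‖χ x * z x‖ₑ ^ q) ^ (1 / q) ≤ 2 * Q := by
    calc (∫⁻ x, ‖χ x * z x‖ₑ ^ q) ^ (1 / q)
        ≤ (∫⁻ x in K, (‖w ((2 : ℝ) • x)‖ₑ + ‖w x‖ₑ) ^ q) ^ (1 / q) := by
          refine ENNReal.rpow_le_rpow ?_ (by positivity)
          rw [← lintegral_indicator hKm]
          refine lintegral_mono fun x => ?_
          by_cases hx : x ∈ K
          · rw [Set.indicator_of_mem hx, enorm_mul]
            refine ENNReal.rpow_le_rpow ?_ hq0.le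
            calc ‖χ x‖ₑ * ‖z x‖ₑ ≤ 1 * ‖z x‖ₑ := by gcongr; exact hχe x
              _ ≤ _ := by rw [one_mul]; exact enorm_sub_le
          · simp [hf0 x hx, hq0]
      _ ≤ (∫⁻ x in K, ‖w ((2 : ℝ) • x)‖ₑ ^ q) ^ (1 / q) + (∫⁻ x in K, ‖w x‖ₑ ^ q) ^ (1 / q) :=
          ENNReal.lintegral_Lp_add_le hw2.continuous.measurable.enorm.aemeasurable
            hw.continuous.measurable.enorm.aemeasurable hq
      _ ≤ Q + Q := by
          refine add_le_add (ENNReal.rpow_le_rpow ?_ (by positivity))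
            (ENNReal.rpow_le_rpow ?_ (by positivity))
          · exact setLIntegral_closedAnnulus_comp_smul_le (by norm_num) (by norm_num) (by norm_num)
              (fun x => ‖w x‖ₑ ^ q)
          · exact lintegral_mono_set (closedAnnulus_subset le_rfl (by norm_num))
      _ = 2 * Q := by ring
  -- the gradient
  have hfd : ∀ x, ‖fderiv ℝ (fun x => χ x * z x) x‖ₑ ≤ K.indicator (fun x =>
      ENNReal.ofReal L * ‖z x‖ₑ + (2 * ‖fderiv ℝ w ((2 : ℝ) • x)‖ₑ + ‖fderiv ℝ w x‖ₑ)) x := by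
    intro x
    by_cases hx : x ∈ K
    · rw [Set.indicator_of_mem hx]
      have e1 : fderiv ℝ (fun x => χ x * z x) x = χ x • fderiv ℝ z x + z x • fderiv ℝ χ x :=
        fderiv_fun_mul (hχ.differentiable one_ne_zero x) (hzC.differentiable one_ne_zero x)
      have e2 : fderiv ℝ z x = (2 : ℝ) • fderiv ℝ w ((2 : ℝ) • x) - fderiv ℝ w x := by
        rw [hz, fderiv_fun_sub (hw2.differentiable one_ne_zero x)
          (hw.differentiable one_ne_zero x), fderiv_comp_smul]
      have e3 : ‖fderiv ℝ χ x‖ₑ ≤ ENNReal.ofReal L := by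
        rw [← ofReal_norm]; exact ENNReal.ofReal_le_ofReal (hL x)
      have e4 : ‖fderiv ℝ z x‖ₑ ≤ 2 * ‖fderiv ℝ w ((2 : ℝ) • x)‖ₑ + ‖fderiv ℝ w x‖ₑ := by
        rw [e2]
        refine enorm_sub_le.trans ?_
        rw [enorm_smul]
        gcongr
        rw [← ofReal_norm]; simp
      rw [e1, add_comm]
      refine (enorm_add_le (z x • fderiv ℝ χ x) (χ x • fderiv ℝ z x)).trans ?_
      rw [enorm_smul, enorm_smul]
      refine add_le_add ?_ ?_
      · rw [mul_comm]; gcongr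
      · calc ‖χ x‖ₑ * ‖fderiv ℝ z x‖ₑ ≤ 1 * ‖fderiv ℝ z x‖ₑ := by gcongr; exact hχe x
          _ ≤ _ := by rw [one_mul]; exact e4
    · rw [Set.indicator_of_notMem hx]
      have : (fun x => χ x * z x) =ᶠ[𝓝 x] fun _ => 0 := by
        filter_upwards [(isClosed_closedAnnulus (d := d) (1 / 2) 4).isOpen_compl.mem_nhds hx]
          with y hy using hf0 y hy
      rw [this.fderiv_eq]
      simp [← ofReal_norm]
  have hP2 : (∫⁻ x, ‖fderiv ℝ (fun x => χ x * z x) x‖ₑ ^ p) ^ (1 / p) ≤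
      (ENNReal.ofReal L * 4 + 3) * P := by
    have hmul : ∀ (c : ℝ≥0∞) (_ : c ≠ ⊤) (F : EuclideanSpace ℝ (Fin d) → ℝ≥0∞),
        (∫⁻ x in K, (c * F x) ^ p) ^ (1 / p) = c * (∫⁻ x in K, F x ^ p) ^ (1 / p) := by
      intro c hc F
      simp_rw [ENNReal.mul_rpow_of_nonneg _ _ hp0.le]
      rw [lintegral_const_mul' _ _ (ENNReal.rpow_ne_top_of_nonneg hp0.le hc),
        ENNReal.mul_rpow_of_nonneg _ _ (by positivity), ← ENNReal.rpow_mul,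
        mul_one_div_cancel hp0.ne', ENNReal.rpow_one]
    calc (∫⁻ x, ‖fderiv ℝ (fun x => χ x * z x) x‖ₑ ^ p) ^ (1 / p)
        ≤ (∫⁻ x in K, (ENNReal.ofReal L * ‖z x‖ₑ +
          (2 * ‖fderiv ℝ w ((2 : ℝ) • x)‖ₑ + ‖fderiv ℝ w x‖ₑ)) ^ p) ^ (1 / p) := by
          refine ENNReal.rpow_le_rpow ?_ (by positivity)
          rw [← lintegral_indicator hKm]
          refine lintegral_mono fun x => ?_
          refine (ENNReal.rpow_le_rpow (hfd x) hp0.le).trans ?_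
          by_cases hx : x ∈ K
          · simp [hx]
          · simp [hx, hp0]
      _ ≤ (∫⁻ x in K, (ENNReal.ofReal L * ‖z x‖ₑ) ^ p) ^ (1 / p) +
          (∫⁻ x in K, (2 * ‖fderiv ℝ w ((2 : ℝ) • x)‖ₑ + ‖fderiv ℝ w x‖ₑ) ^ p) ^ (1 / p) :=
          ENNReal.lintegral_Lp_add_le (hzC.continuous.measurable.enorm.const_mul _).aemeasurable
            ((hw'2.measurable.enorm.const_mul _).add hw'.measurable.enorm).aemeasurable hp
      _ ≤ (∫⁻ x in K, (ENNReal.ofReal L * ‖z x‖ₑ) ^ p) ^ (1 / p) +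
          ((∫⁻ x in K, (2 * ‖fderiv ℝ w ((2 : ℝ) • x)‖ₑ) ^ p) ^ (1 / p) +
            (∫⁻ x in K, ‖fderiv ℝ w x‖ₑ ^ p) ^ (1 / p)) := by
          gcongr
          exact ENNReal.lintegral_Lp_add_le (hw'2.measurable.enorm.const_mul _).aemeasurable
            hw'.measurable.enorm.aemeasurable hp
      _ ≤ ENNReal.ofReal L * (4 * P) + (2 * P + P) := by
          rw [hmul _ ENNReal.ofReal_ne_top, hmul 2 (by simp)]
          refine add_le_add (mul_le_mul_right ?_ _) (add_le_add (mul_le_mul_right ?_ _) ?_)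
          · have h4 : (4 : ℝ≥0∞) = (4 ^ p) ^ (1 / p) := by
              rw [← ENNReal.rpow_mul, mul_one_div_cancel hp0.ne', ENNReal.rpow_one]
            rw [h4, hP, ← ENNReal.mul_rpow_of_nonneg _ _ (by positivity)]
            exact ENNReal.rpow_le_rpow (lintegral_closedAnnulus_sub_rpow_le hw hp) (by positivity)
          · refine ENNReal.rpow_le_rpow ?_ (by positivity)
            exact setLIntegral_closedAnnulus_comp_smul_le (by norm_num) (by norm_num) (by norm_num)
              (fun x => ‖fderiv ℝ w x‖ₑ ^ p)
          · refine ENNReal.rpow_le_rpow ?_ (by positivity)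
            exact lintegral_mono_set (closedAnnulus_subset le_rfl (by norm_num))
      _ = _ := by ring
  calc _ ≤ _ := hleft.trans h1
    _ ≤ C * (((ENNReal.ofReal L * 4 + 3) * P) ^ a * (2 * Q) ^ (1 - a)) := by
        gcongr
    _ = _ := by
        rw [ENNReal.mul_rpow_of_nonneg _ _ ha0.le,
          ENNReal.mul_rpow_of_nonneg _ _ (by linarith : 0 ≤ 1 - a)]
        ring

/-! ### Mollification and passage to weak gradients -/

open scoped Convolution in
open ContinuousLinearMap in
theorem enorm_convolution_normed_le {d : ℕ} (φ : ContDiffBump (0 : EuclideanSpace ℝ (Fin d)))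
    (u : EuclideanSpace ℝ (Fin d) → ℝ) (x : EuclideanSpace ℝ (Fin d)) :
    ‖(φ.normed volume ⋆[lsmul ℝ ℝ, volume] u) x‖ₑ ≤
      ∫⁻ y, ‖φ.normed volume (x - y)‖ₑ * ‖u y‖ₑ := by
  rw [convolution_lsmul_swap]
  refine (enorm_integral_le_lintegral_enorm _).trans (le_of_eq ?_)
  simp_rw [enorm_smul]

open scoped Convolution in
open ContinuousLinearMap in
/-- The gradient of a mollification is bounded by the mollification of the weak gradient. -/
theorem enorm_fderiv_convolution_normed_le {d : ℕ}
    (φ : ContDiffBump (0 : EuclideanSpace ℝ (Fin d))) {u : EuclideanSpace ℝ (Fin d) → ℝ}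
    {g : EuclideanSpace ℝ (Fin d) → EuclideanSpace ℝ (Fin d)}
    (hu : LocallyIntegrableOn u {0}ᶜ) (hg : IsWeakGradientPunctured u g) {r R : ℝ} (hr : 0 < r)
    {x : EuclideanSpace ℝ (Fin d)}
    (hx : Metric.closedBall x φ.rOut ⊆ closedAnnulus d r R) :
    ‖fderiv ℝ (φ.normed volume ⋆[lsmul ℝ ℝ, volume] (closedAnnulus d r R).indicator u) x‖ₑ ≤
      ∫⁻ y, ‖φ.normed volume (x - y)‖ₑ * ‖(closedAnnulus d r R).indicator g y‖ₑ := by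
  set A := closedAnnulus d r R with hA
  have hAm : MeasurableSet A := (isClosed_closedAnnulus _ _).measurableSet
  have hui : LocallyIntegrable (A.indicator u) :=
    ((integrable_indicator_iff hAm).2 (hu.integrableOn_compact_subset
      (closedAnnulus_subset_compl_zero hr) (isCompact_closedAnnulus r R))).locallyIntegrable
  set ρ := φ.normed volume with hρ
  have hρC : ContDiff ℝ 1 ρ := φ.contDiff_normed (n := 1)
  have hρc : HasCompactSupport ρ := φ.hasCompactSupport_normed
  have hρA : ∀ y ∉ A, ρ (x - y) = 0 := by
    intro y hy
    by_contra h
    have h1 : x - y ∈ Function.support ρ := h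
    rw [hρ, φ.support_normed_eq, mem_ball_zero_iff] at h1
    exact hy (hx (by
      rw [Metric.mem_closedBall, dist_comm, dist_eq_norm]; exact h1.le))
  have hρts : ∀ y ∉ A, x - y ∉ tsupport ρ := by
    intro y hy h1
    rw [hρ, φ.tsupport_normed_eq, mem_closedBall_zero_iff] at h1
    exact hy (hx (by rw [Metric.mem_closedBall, dist_comm, dist_eq_norm]; exact h1))
  have hρ'A : ∀ y ∉ A, fderiv ℝ ρ (x - y) = 0 := fun y hy => by
    by_contra h
    exact hρts y hy (support_fderiv_subset ℝ h)
  refine opENorm_le_bound _ fun v => ?_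
  -- the formula for the directional derivative
  have h1 := (hρc.hasFDerivAt_convolution_left (lsmul ℝ ℝ) hρC hui x).fderiv
  rw [convolution_eq_swap] at h1
  have h2 := congrArg (fun L => L v) h1
  rw [ContinuousLinearMap.integral_apply
    (((hρc.fderiv (𝕜 := ℝ)).convolutionExists_left _ (hρC.continuous_fderiv one_ne_zero)
      hui x).integrable_swap)] at h2
  simp only [precompL_apply, lsmul_apply, smul_eq_mul] at h2
  -- the test function
  have hψts : tsupport (fun y => ρ (x - y)) ⊆ A := by
    refine closure_minimal ?_ (isClosed_closedAnnulus _ _)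
    intro y hy
    by_contra h
    exact hy (hρA y h)
  have h3 := hg.2 (fun y => ρ (x - y))
    ((φ.contDiff_normed (n := ⊤)).comp (contDiff_const.sub contDiff_id))
    ((isCompact_closedAnnulus r R).of_isClosed_subset (isClosed_tsupport _) hψts)
    (hψts.trans (closedAnnulus_subset_compl_zero hr)) v
  have h4 : ∀ y, fderiv ℝ (fun y => ρ (x - y)) y v = -(fderiv ℝ ρ (x - y) v) := by
    intro y
    have h6 : HasFDerivAt (fun y : EuclideanSpace ℝ (Fin d) => x - y)
        (-ContinuousLinearMap.id ℝ _) y := (hasFDerivAt_id y).const_sub x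
    have h7 : HasFDerivAt (fun y => ρ (x - y)) ((fderiv ℝ ρ (x - y)).comp
        (-ContinuousLinearMap.id ℝ _)) y :=
      (hρC.differentiable one_ne_zero (x - y)).hasFDerivAt.comp y h6
    rw [h7.fderiv]
    simp
  simp_rw [h4, mul_neg] at h3
  rw [integral_neg, neg_inj] at h3
  -- Truncating u to the annulus changes nothing here, since the derivative of the kernel centred at
  -- x vanishes off the annulus.
  have h5 : ∀ y, fderiv ℝ ρ (x - y) v * A.indicator u y = u y * fderiv ℝ ρ (x - y) v := by
    intro y
    by_cases hy : y ∈ A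
    · rw [Set.indicator_of_mem hy, mul_comm]
    · simp [hρ'A y hy]
  simp_rw [h5] at h2
  rw [h3] at h2
  rw [h2]
  refine (enorm_integral_le_lintegral_enorm _).trans ?_
  rw [← lintegral_mul_const' _ _ enorm_ne_top]
  refine lintegral_mono fun y => ?_
  by_cases hy : y ∈ A
  · rw [Set.indicator_of_mem hy, enorm_mul]
    calc ‖inner ℝ (g y) v‖ₑ * ‖ρ (x - y)‖ₑ ≤ (‖g y‖ₑ * ‖v‖ₑ) * ‖ρ (x - y)‖ₑ := by
          gcongr
          rw [← ofReal_norm, ← ofReal_norm, ← ofReal_norm, ← ENNReal.ofReal_mul (norm_nonneg _)]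
          exact ENNReal.ofReal_le_ofReal (norm_inner_le_norm _ _)
      _ = _ := by ring
  · simp [hρA y hy]

/-- Mollification does not increase `L^p` norms. -/
theorem setLIntegral_mollification_rpow_le {d : ℕ} {F : Type*} [NormedAddCommGroup F]
    (φ : ContDiffBump (0 : EuclideanSpace ℝ (Fin d))) {f : EuclideanSpace ℝ (Fin d) → F}
    (hf : AEStronglyMeasurable f) {p : ℝ} (hp : 1 ≤ p) (S : Set (EuclideanSpace ℝ (Fin d))) :
    ∫⁻ x in S, (∫⁻ y, ‖φ.normed volume (x - y)‖ₑ * ‖f y‖ₑ) ^ p ≤ ∫⁻ y, ‖f y‖ₑ ^ p := by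
  set ρ := φ.normed volume with hρ
  have hρc : Continuous ρ := φ.continuous_normed
  have hmass : ∫⁻ x, ‖ρ x‖ₑ = 1 := by
    have h1 : ∀ x, ‖ρ x‖ₑ = ENNReal.ofReal (ρ x) := fun x =>
      Real.enorm_of_nonneg (φ.nonneg_normed x)
    simp_rw [h1]
    rw [← ofReal_integral_eq_lintegral_ofReal φ.integrable_normed
      (Filter.Eventually.of_forall φ.nonneg_normed), φ.integral_normed, ENNReal.ofReal_one]
  have hm : AEMeasurable (fun z : EuclideanSpace ℝ (Fin d) × EuclideanSpace ℝ (Fin d) =>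
      ‖ρ (z.1 - z.2)‖ₑ * ‖f z.2‖ₑ ^ p) (volume.prod volume) := by
    refine AEMeasurable.mul ?_ ?_
    · exact (hρc.comp (continuous_fst.sub continuous_snd)).measurable.enorm.aemeasurable
    · exact (hf.enorm.pow_const p).comp_quasiMeasurePreserving
        Measure.quasiMeasurePreserving_snd
  calc ∫⁻ x in S, (∫⁻ y, ‖ρ (x - y)‖ₑ * ‖f y‖ₑ) ^ p
      ≤ ∫⁻ x, (∫⁻ y, ‖ρ (x - y)‖ₑ * ‖f y‖ₑ) ^ p := setLIntegral_le_lintegral _ _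
    _ ≤ ∫⁻ x, ∫⁻ y, ‖ρ (x - y)‖ₑ * ‖f y‖ₑ ^ p := by
        refine lintegral_mono fun x => ?_
        have h1 : Continuous fun y => ρ (x - y) := hρc.comp (continuous_const.sub continuous_id)
        refine lintegral_mul_rpow_le h1.measurable.enorm.aemeasurable hf.enorm ?_ hp
        rw [lintegral_sub_left_eq_self (fun y => ‖ρ y‖ₑ) x, hmass]
    _ = ∫⁻ y, ∫⁻ x, ‖ρ (x - y)‖ₑ * ‖f y‖ₑ ^ p := lintegral_lintegral_swap hm
    _ = ∫⁻ y, ‖f y‖ₑ ^ p := by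
        refine lintegral_congr fun y => ?_
        have h1 : Continuous fun x => ρ (x - y) := hρc.comp (continuous_id.sub continuous_const)
        rw [lintegral_mul_const _ h1.measurable.enorm,
          lintegral_sub_right_eq_self (fun x => ‖ρ x‖ₑ) y, hmass, one_mul]

theorem quasiMeasurePreserving_smul {d : ℕ} {t : ℝ} (ht : 0 < t) :
    Measure.QuasiMeasurePreserving (fun x : EuclideanSpace ℝ (Fin d) => t • x) volume volume := by
  refine ⟨measurable_const_smul t, ?_⟩
  change Measure.map (t • ·) volume ≪ _
  rw [Measure.map_addHaar_smul _ ht.ne']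
  exact Measure.smul_absolutelyContinuous

/-- The dyadic increment of a weakly differentiable function satisfies a Gagliardo–Nirenberg
inequality on an annulus without lower order terms. -/
theorem exists_closedAnnulus_sub_le {d : ℕ} (hd : 1 ≤ d) {p q τ a : ℝ}
    (hp : 1 ≤ p) (hq : 1 ≤ q) (hτ : 1 ≤ τ) (ha0 : 0 < a) (ha1 : a ≤ 1)
    (h : a * (1 / p - 1 / d) + (1 - a) * (1 / q) ≤ 1 / τ) :
    ∃ C : ℝ≥0∞, C ≠ ⊤ ∧ ∀ (u : EuclideanSpace ℝ (Fin d) → ℝ)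
      (g : EuclideanSpace ℝ (Fin d) → EuclideanSpace ℝ (Fin d)), LocallyIntegrableOn u {0}ᶜ →
      IsWeakGradientPunctured u g →
      (∫⁻ x in closedAnnulus d 1 2, ‖u ((2 : ℝ) • x) - u x‖ₑ ^ τ) ^ (1 / τ) ≤
        C * (((∫⁻ x in closedAnnulus d (1 / 4) 16, ‖g x‖ₑ ^ p) ^ (1 / p)) ^ a *
          ((∫⁻ x in closedAnnulus d (1 / 4) 16, ‖u x‖ₑ ^ q) ^ (1 / q)) ^ (1 - a)) := by
  have hp0 : 0 < p := by linarith
  have hq0 : 0 < q := by linarith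
  have hτ0 : 0 < τ := by linarith
  obtain ⟨C, hC, hloc⟩ := exists_closedAnnulus_sub_le_of_contDiff hd hp hq hτ ha0 ha1 h
  refine ⟨C, hC, ?_⟩
  intro u g hu hg
  set A := closedAnnulus d (1 / 4) 16 with hA
  have hAm : MeasurableSet A := (isClosed_closedAnnulus _ _).measurableSet
  have hA0 : A ⊆ {0}ᶜ := closedAnnulus_subset_compl_zero (by norm_num)
  have hui : Integrable (A.indicator u) := (integrable_indicator_iff hAm).2
    (hu.integrableOn_compact_subset hA0 (isCompact_closedAnnulus _ _))
  have hgi : Integrable (A.indicator g) := (integrable_indicator_iff hAm).2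
    (hg.1.integrableOn_compact_subset hA0 (isCompact_closedAnnulus _ _))
  set RHS := C * (((∫⁻ x in A, ‖g x‖ₑ ^ p) ^ (1 / p)) ^ a *
    ((∫⁻ x in A, ‖u x‖ₑ ^ q) ^ (1 / q)) ^ (1 - a)) with hRHS
  -- The radii are at most 1/5 < 1/4, so balls centred in {1/2 ≤ ‖x‖ ≤ 8} stay in {1/4 ≤ ‖x‖ ≤ 16}.
  -- The fixed ratio 2 of the radii is what almost everywhere convergence of the mollifications
  -- requires.
  let φ : ℕ → ContDiffBump (0 : EuclideanSpace ℝ (Fin d)) := fun n =>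
    { rIn := 1 / ((n : ℝ) + 10)
      rOut := 2 / ((n : ℝ) + 10)
      rIn_pos := by positivity
      rIn_lt_rOut := by gcongr; norm_num }
  have hφle : ∀ n, (φ n).rOut ≤ 1 / 5 := by
    intro n
    change 2 / ((n : ℝ) + 10) ≤ 1 / 5
    rw [div_le_div_iff₀ (by positivity) (by norm_num)]
    have : (0 : ℝ) ≤ n := by positivity
    linarith
  let w : ℕ → EuclideanSpace ℝ (Fin d) → ℝ := fun n =>
    convolution ((φ n).normed volume) (A.indicator u) (ContinuousLinearMap.lsmul ℝ ℝ) volume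
  have hw : ∀ n, ContDiff ℝ 1 (w n) := fun n =>
    (φ n).hasCompactSupport_normed.contDiff_convolution_left (n := 1) _
      ((φ n).contDiff_normed (n := 1)) hui.locallyIntegrable
  have hball : ∀ n, ∀ x ∈ closedAnnulus d (1 / 2) 8, Metric.closedBall x (φ n).rOut ⊆ A := by
    intro n x hx y hy
    rw [Metric.mem_closedBall, dist_eq_norm] at hy
    have h1 := hφle n
    have h2 := norm_sub_norm_le x y
    have h3 := norm_sub_norm_le y x
    rw [norm_sub_rev] at h2
    exact ⟨by linarith [hx.1], by linarith [hx.2]⟩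
  have hbound : ∀ n, ∫⁻ x in closedAnnulus d 1 2, ‖w n ((2 : ℝ) • x) - w n x‖ₑ ^ τ ≤ RHS ^ τ := by
    intro n
    have h1 := hloc (w n) (hw n)
    have h2 : ∫⁻ x in closedAnnulus d (1 / 2) 8, ‖fderiv ℝ (w n) x‖ₑ ^ p ≤
        ∫⁻ x in A, ‖g x‖ₑ ^ p := by
      calc _ ≤ ∫⁻ x in closedAnnulus d (1 / 2) 8,
            (∫⁻ y, ‖(φ n).normed volume (x - y)‖ₑ * ‖A.indicator g y‖ₑ) ^ p := by
            refine setLIntegral_mono' (isClosed_closedAnnulus _ _).measurableSet fun x hx => ?_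
            exact ENNReal.rpow_le_rpow (enorm_fderiv_convolution_normed_le (φ n) hu hg
              (by norm_num) (hball n x hx)) hp0.le
        _ ≤ ∫⁻ y, ‖A.indicator g y‖ₑ ^ p :=
            setLIntegral_mollification_rpow_le (φ n) hgi.aestronglyMeasurable hp _
        _ = _ := by
            rw [← lintegral_indicator hAm]
            refine lintegral_congr fun y => ?_
            by_cases hy : y ∈ A <;> simp [hy, hp0]
    have h3 : ∫⁻ x in closedAnnulus d (1 / 2) 8, ‖w n x‖ₑ ^ q ≤ ∫⁻ x in A, ‖u x‖ₑ ^ q := by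
      calc _ ≤ ∫⁻ x in closedAnnulus d (1 / 2) 8,
            (∫⁻ y, ‖(φ n).normed volume (x - y)‖ₑ * ‖A.indicator u y‖ₑ) ^ q := by
            refine lintegral_mono fun x => ?_
            exact ENNReal.rpow_le_rpow (enorm_convolution_normed_le (φ n) _ x) hq0.le
        _ ≤ ∫⁻ y, ‖A.indicator u y‖ₑ ^ q :=
            setLIntegral_mollification_rpow_le (φ n) hui.aestronglyMeasurable hq _
        _ = _ := by
            rw [← lintegral_indicator hAm]
            refine lintegral_congr fun y => ?_
            by_cases hy : y ∈ A <;> simp [hy, hq0]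
    have h4 : (∫⁻ x in closedAnnulus d 1 2, ‖w n ((2 : ℝ) • x) - w n x‖ₑ ^ τ) ^ (1 / τ) ≤ RHS := by
      refine h1.trans ?_
      rw [hRHS]
      refine mul_le_mul_right (mul_le_mul' ?_ ?_) _
      · exact ENNReal.rpow_le_rpow (ENNReal.rpow_le_rpow h2 (by positivity)) ha0.le
      · exact ENNReal.rpow_le_rpow (ENNReal.rpow_le_rpow h3 (by positivity)) (by linarith)
    rw [one_div] at h4
    exact (ENNReal.rpow_inv_le_iff hτ0).1 h4
  have hae : ∀ᵐ x : EuclideanSpace ℝ (Fin d),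
      Filter.Tendsto (fun n => w n x) Filter.atTop (𝓝 (A.indicator u x)) := by
    refine ContDiffBump.ae_convolution_tendsto_right_of_locallyIntegrable (K := 2) ?_ ?_
      hui.locallyIntegrable
    · exact tendsto_const_nhds.div_atTop
        (Filter.tendsto_atTop_add_const_right _ _ tendsto_natCast_atTop_atTop)
    · refine Filter.Eventually.of_forall fun n => le_of_eq ?_
      change 2 / ((n : ℝ) + 10) = 2 * (1 / ((n : ℝ) + 10))
      ring
  have hae2 := (quasiMeasurePreserving_smul (d := d) (t := 2) (by norm_num)).ae hae
  rw [one_div, ENNReal.rpow_inv_le_iff hτ0]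
  -- Fatou's lemma: the bound for the mollifications is uniform in n, so only pointwise convergence
  -- is needed and the right side may be infinite.
  calc ∫⁻ x in closedAnnulus d 1 2, ‖u ((2 : ℝ) • x) - u x‖ₑ ^ τ
      ≤ ∫⁻ x in closedAnnulus d 1 2,
        Filter.liminf (fun n => ‖w n ((2 : ℝ) • x) - w n x‖ₑ ^ τ) Filter.atTop := by
        refine lintegral_mono_ae ?_
        filter_upwards [ae_restrict_of_ae hae, ae_restrict_of_ae hae2,
          ae_restrict_mem (isClosed_closedAnnulus _ _).measurableSet] with x h1 h2 hx
        have hx1 : x ∈ A := closedAnnulus_subset (by norm_num) (by norm_num) hx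
        have hx2 : (2 : ℝ) • x ∈ A := by
          rw [hA, closedAnnulus, Set.mem_ofPred_eq, norm_smul]
          have := hx.1
          have := hx.2
          norm_num
          constructor <;> linarith
        rw [Set.indicator_of_mem hx1] at h1
        rw [Set.indicator_of_mem hx2] at h2
        have h3 : Filter.Tendsto (fun n => ‖w n ((2 : ℝ) • x) - w n x‖ₑ ^ τ) Filter.atTop
            (𝓝 (‖u ((2 : ℝ) • x) - u x‖ₑ ^ τ)) :=
          (ENNReal.continuous_rpow_const.tendsto _).comp ((h2.sub h1).enorm)
        exact h3.liminf_eq.ge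
    _ ≤ Filter.liminf (fun n => ∫⁻ x in closedAnnulus d 1 2,
          ‖w n ((2 : ℝ) • x) - w n x‖ₑ ^ τ) Filter.atTop := by
        refine lintegral_liminf_le fun n => ?_
        have h1 : Continuous fun x : EuclideanSpace ℝ (Fin d) => w n ((2 : ℝ) • x) :=
          (hw n).continuous.comp (continuous_const_smul (2 : ℝ))
        exact ((h1.sub (hw n).continuous).measurable.enorm).pow_const τ
    _ ≤ RHS ^ τ := by
        refine (Filter.liminf_le_liminf (Filter.Eventually.of_forall hbound)).trans ?_
        simp

/-! ### Weights and scaling -/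

/-- The `L^p` norm over a set of a function with values in `[0, ∞]`. -/
noncomputable def setLp {d : ℕ} (S : Set (EuclideanSpace ℝ (Fin d))) (p : ℝ)
    (f : EuclideanSpace ℝ (Fin d) → ℝ≥0∞) : ℝ≥0∞ := (∫⁻ x in S, f x ^ p) ^ (1 / p)

theorem setLp_mono_set {d : ℕ} {S T : Set (EuclideanSpace ℝ (Fin d))} (h : S ⊆ T) {p : ℝ}
    (hp : 0 < p) (f : EuclideanSpace ℝ (Fin d) → ℝ≥0∞) : setLp S p f ≤ setLp T p f :=
  ENNReal.rpow_le_rpow (lintegral_mono_set h) (by positivity)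

theorem setLp_le_mul {d : ℕ} {S : Set (EuclideanSpace ℝ (Fin d))} (hS : MeasurableSet S) {p : ℝ}
    (hp : 0 < p) {f g : EuclideanSpace ℝ (Fin d) → ℝ≥0∞} {c : ℝ≥0∞} (hc : c ≠ ⊤)
    (h : ∀ x ∈ S, f x ≤ c * g x) : setLp S p f ≤ c * setLp S p g := by
  have h1 : c = (c ^ p) ^ (1 / p) := by
    rw [← ENNReal.rpow_mul, mul_one_div_cancel hp.ne', ENNReal.rpow_one]
  rw [setLp, setLp]
  nth_rw 1 [h1]
  rw [← ENNReal.mul_rpow_of_nonneg _ _ (by positivity),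
    ← lintegral_const_mul' _ _ (ENNReal.rpow_ne_top_of_nonneg hp.le hc)]
  refine ENNReal.rpow_le_rpow ?_ (by positivity)
  refine setLIntegral_mono' hS fun x hx => ?_
  rw [← ENNReal.mul_rpow_of_nonneg _ _ hp.le]
  exact ENNReal.rpow_le_rpow (h x hx) hp.le

theorem setLp_comp_smul {d : ℕ} {l : ℝ} (hl : 0 < l) {p : ℝ} (hp : 0 < p) (r R : ℝ)
    (f : EuclideanSpace ℝ (Fin d) → ℝ≥0∞) :
    setLp (closedAnnulus d r R) p (fun x => f (l • x)) =
      ENNReal.ofReal (l ^ (-(d / p) : ℝ)) * setLp (closedAnnulus d (l * r) (l * R)) p f := by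
  rw [setLp, setLp, ← preimage_smul_closedAnnulus hl,
    setLIntegral_comp_smul hl (isClosed_closedAnnulus _ _).measurableSet (fun x => f x ^ p),
    ENNReal.mul_rpow_of_nonneg _ _ (by positivity), ENNReal.ofReal_rpow_of_pos (by positivity)]
  congr 2
  rw [← Real.rpow_natCast, ← Real.rpow_neg hl.le, ← Real.rpow_mul hl.le]
  congr 1
  ring

theorem rpow_le_of_mem_closedAnnulus {d : ℕ} {l : ℝ} (hl : 0 < l) (α : ℝ)
    {x : EuclideanSpace ℝ (Fin d)} (hx : x ∈ closedAnnulus d (l * (1 / 4)) (l * 16)) :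
    ‖x‖ ^ α ≤ 16 ^ |α| * l ^ α ∧ l ^ α ≤ 16 ^ |α| * ‖x‖ ^ α := by
  have hx0 : 0 < ‖x‖ := lt_of_lt_of_le (by positivity) hx.1
  have key : ∀ s t : ℝ, 0 < s → 0 < t → s ≤ 16 * t → t ≤ 16 * s →
      s ^ α ≤ 16 ^ |α| * t ^ α := by
    intro s t hs ht h1 h2
    rcases le_total 0 α with h | h
    · rw [abs_of_nonneg h, ← Real.mul_rpow (by norm_num) ht.le]
      exact Real.rpow_le_rpow hs.le h1 h
    · have h3 : (16 * s) ^ α ≤ t ^ α := Real.rpow_le_rpow_of_nonpos ht h2 h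
      rw [Real.mul_rpow (by norm_num) hs.le] at h3
      calc s ^ α = 16 ^ |α| * (16 ^ α * s ^ α) := by
            rw [← mul_assoc, ← Real.rpow_add (by norm_num), abs_of_nonpos h]
            simp
        _ ≤ _ := by gcongr
  have h1 := hx.1
  have h2 := hx.2
  exact ⟨key _ _ hx0 hl (by linarith) (by linarith), key _ _ hl hx0 (by linarith) (by linarith)⟩

theorem locallyIntegrableOn_compl_zero_comp_smul {d : ℕ} {F : Type*}
    [NormedAddCommGroup F] [NormedSpace ℝ F] {l : ℝ} (hl : 0 < l)
    {f : EuclideanSpace ℝ (Fin d) → F}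
    (hf : LocallyIntegrableOn f {0}ᶜ) : LocallyIntegrableOn (fun x => f (l • x)) {0}ᶜ := by
  rw [locallyIntegrableOn_iff (isOpen_compl_singleton.isLocallyClosed)] at hf ⊢
  intro K hK hKc
  have hK' : IsCompact ((fun x => l • x) '' K) := hKc.image (continuous_const_smul l)
  have h1 := hf _ (by
    rintro _ ⟨x, hx, rfl⟩
    simpa [hl.ne'] using hK hx) hK'
  rw [← integrable_indicator_iff hK'.measurableSet] at h1
  rw [← integrable_indicator_iff hKc.measurableSet]
  have h2 := (integrable_comp_smul_iff volume _ hl.ne').2 h1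
  refine h2.congr (Filter.Eventually.of_forall fun x => ?_)
  have h3 : l • x ∈ (fun x => l • x) '' K ↔ x ∈ K :=
    (smul_right_injective _ hl.ne').mem_set_image
  by_cases hx : x ∈ K
  · rw [Set.indicator_of_mem hx]
    exact Set.indicator_of_mem (h3.2 hx) _
  · rw [Set.indicator_of_notMem hx]
    exact Set.indicator_of_notMem (fun h => hx (h3.1 h)) _

theorem IsWeakGradientPunctured.comp_smul {d : ℕ} {u : EuclideanSpace ℝ (Fin d) → ℝ}
    {g : EuclideanSpace ℝ (Fin d) → EuclideanSpace ℝ (Fin d)} (hg : IsWeakGradientPunctured u g)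
    {l : ℝ} (hl : 0 < l) :
    IsWeakGradientPunctured (fun x => u (l • x)) (fun x => l • g (l • x)) := by
  refine ⟨(locallyIntegrableOn_compl_zero_comp_smul hl hg.1).smul l, ?_⟩
  intro φ hφ hφc hφ0 v
  have hts : tsupport (fun y => φ (l⁻¹ • y)) ⊆ {0}ᶜ := by
    intro y hy
    have h1 : l⁻¹ • y ∈ tsupport φ :=
      tsupport_comp_subset_preimage φ (continuous_const_smul l⁻¹) hy
    intro h0
    rw [Set.mem_singleton_iff] at h0
    exact hφ0 h1 (by simp [h0])
  have hc : HasCompactSupport (fun y => φ (l⁻¹ • y)) :=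
    hφc.comp_smul (inv_ne_zero hl.ne')
  have h1 := hg.2 (fun y => φ (l⁻¹ • y)) (hφ.comp (contDiff_const_smul l⁻¹)) hc hts v
  have h2 := Measure.integral_comp_smul (volume : Measure (EuclideanSpace ℝ (Fin d)))
    (fun y => u y * fderiv ℝ (fun y => φ (l⁻¹ • y)) y v) l
  have h3 := Measure.integral_comp_smul (volume : Measure (EuclideanSpace ℝ (Fin d)))
    (fun y => inner ℝ (g y) v * φ (l⁻¹ • y)) l
  rw [h1, smul_neg, ← h3] at h2
  have e1 : ∀ x, u (l • x) * fderiv ℝ (fun y => φ (l⁻¹ • y)) (l • x) v =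
      l⁻¹ * (u (l • x) * fderiv ℝ φ x v) := by
    intro x
    rw [fderiv_comp_smul, smul_smul, inv_mul_cancel₀ hl.ne', one_smul]
    simp only [smul_apply, smul_eq_mul]
    ring
  simp_rw [e1, smul_smul, inv_mul_cancel₀ hl.ne', one_smul, integral_const_mul] at h2
  have e2 : ∀ x, inner ℝ (l • g (l • x)) v * φ x = l * (inner ℝ (g (l • x)) v * φ x) := by
    intro x
    rw [real_inner_smul_left, mul_assoc]
  simp_rw [e2, integral_const_mul]
  field_simp at h2
  linarith

/-- The annulus inequality at all scales, with power weights. -/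
theorem exists_setLp_closedAnnulus_sub_le {d : ℕ} (hd : 1 ≤ d) {p q τ a : ℝ} (α β γ : ℝ)
    (hp : 1 ≤ p) (hq : 1 ≤ q) (hτ : 1 ≤ τ) (ha0 : 0 < a) (ha1 : a ≤ 1)
    (h : a * (1 / p - 1 / d) + (1 - a) * (1 / q) ≤ 1 / τ) :
    ∃ C : ℝ≥0∞, C ≠ ⊤ ∧ ∀ (u : EuclideanSpace ℝ (Fin d) → ℝ)
      (g : EuclideanSpace ℝ (Fin d) → EuclideanSpace ℝ (Fin d)), LocallyIntegrableOn u {0}ᶜ →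
      IsWeakGradientPunctured u g → ∀ l : ℝ, 0 < l →
      setLp (closedAnnulus d (l * 1) (l * 2)) τ
          (fun x => ‖‖x‖ ^ γ * (u ((2 : ℝ) • x) - u x)‖ₑ) ≤
        C * ENNReal.ofReal (l ^ (d / τ + γ - a * (d / p + α - 1) - (1 - a) * (d / q + β))) *
          (setLp (closedAnnulus d (l * (1 / 4)) (l * 16)) p (fun x => ‖‖x‖ ^ α • g x‖ₑ) ^ a *
          setLp (closedAnnulus d (l * (1 / 4)) (l * 16)) q (fun x => ‖‖x‖ ^ β * u x‖ₑ) ^ (1 - a)) := by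
  have hp0 : 0 < p := by linarith
  have hq0 : 0 < q := by linarith
  have hτ0 : 0 < τ := by linarith
  obtain ⟨C, hC, hloc⟩ := exists_closedAnnulus_sub_le hd hp hq hτ ha0 ha1 h
  -- On the annulus of scale l the weight ‖x‖^δ agrees with l^δ up to the factor 16^|δ|, for each of
  -- the three weights.
  refine ⟨C * ENNReal.ofReal (16 ^ |γ| * ((16 ^ |α|) ^ a * (16 ^ |β|) ^ (1 - a))),
    ENNReal.mul_ne_top hC ENNReal.ofReal_ne_top, ?_⟩
  intro u g hu hg l hl
  -- The estimate at scale 1 for u(l·). The resulting power of l is zero exactly under the balance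
  -- law for a; it is kept general because a will also be perturbed.
  have h1 := hloc (fun x => u (l • x)) (fun x => l • g (l • x))
    (locallyIntegrableOn_compl_zero_comp_smul hl hu) (hg.comp_smul hl)
  change setLp (closedAnnulus d 1 2) τ (fun x => ‖u (l • (2 : ℝ) • x) - u (l • x)‖ₑ) ≤
    C * (setLp (closedAnnulus d (1 / 4) 16) p (fun x => ‖l • g (l • x)‖ₑ) ^ a *
      setLp (closedAnnulus d (1 / 4) 16) q (fun x => ‖u (l • x)‖ₑ) ^ (1 - a)) at h1
  set A := closedAnnulus d (l * (1 / 4)) (l * 16) with hA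
  have hAm : MeasurableSet A := (isClosed_closedAnnulus _ _).measurableSet
  set U := setLp A p (fun x => ‖‖x‖ ^ α • g x‖ₑ)
  set V := setLp A q (fun x => ‖‖x‖ ^ β * u x‖ₑ)
  have hweight : ∀ (δ : ℝ) (x : EuclideanSpace ℝ (Fin d)), x ∈ A →
      ENNReal.ofReal (l ^ δ) ≤ ENNReal.ofReal (16 ^ |δ|) * ‖‖x‖ ^ δ‖ₑ ∧
      ‖‖x‖ ^ δ‖ₑ ≤ ENNReal.ofReal (16 ^ |δ| * l ^ δ) := by
    intro δ x hx
    obtain ⟨h2, h3⟩ := rpow_le_of_mem_closedAnnulus hl δ hx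
    rw [Real.enorm_of_nonneg (by positivity), ← ENNReal.ofReal_mul (by positivity)]
    exact ⟨ENNReal.ofReal_le_ofReal h3, ENNReal.ofReal_le_ofReal h2⟩
  have hinv : ∀ δ : ℝ, ENNReal.ofReal (l ^ (-δ)) * ENNReal.ofReal (l ^ δ) = 1 := by
    intro δ
    rw [← ENNReal.ofReal_mul (by positivity), ← Real.rpow_add hl]
    simp
  -- the gradient
  have hU : setLp (closedAnnulus d (1 / 4) 16) p (fun x => ‖l • g (l • x)‖ₑ) ≤
      ENNReal.ofReal (l ^ (-(d / p + α - 1)) * 16 ^ |α|) * U := by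
    rw [setLp_comp_smul hl hp0 (1 / 4) 16 (fun x => ‖l • g x‖ₑ)]
    have h2 : setLp A p (fun x => ‖l • g x‖ₑ) ≤ ENNReal.ofReal (l * l ^ (-α) * 16 ^ |α|) * U := by
      refine setLp_le_mul hAm hp0 ENNReal.ofReal_ne_top fun x hx => ?_
      rw [enorm_smul, enorm_smul, Real.enorm_of_nonneg hl.le, mul_assoc,
        ENNReal.ofReal_mul hl.le, ENNReal.ofReal_mul (by positivity)]
      calc ENNReal.ofReal l * ‖g x‖ₑ
          = ENNReal.ofReal l * ((ENNReal.ofReal (l ^ (-α)) * ENNReal.ofReal (l ^ α)) * ‖g x‖ₑ) := by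
            rw [hinv, one_mul]
        _ ≤ ENNReal.ofReal l * ((ENNReal.ofReal (l ^ (-α)) *
              (ENNReal.ofReal (16 ^ |α|) * ‖‖x‖ ^ α‖ₑ)) * ‖g x‖ₑ) := by
            gcongr
            exact (hweight α x hx).1
        _ = _ := by ring
    calc _ ≤ ENNReal.ofReal (l ^ (-(d / p))) *
          (ENNReal.ofReal (l * l ^ (-α) * 16 ^ |α|) * U) := by gcongr
      _ = _ := by
        rw [← mul_assoc, ← ENNReal.ofReal_mul (by positivity)]
        congr 2
        rw [show -(d / p + α - 1) = -(d / p) + (1 + -α) by ring, Real.rpow_add hl,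
          Real.rpow_add hl, Real.rpow_one]
        ring
  have hV : setLp (closedAnnulus d (1 / 4) 16) q (fun x => ‖u (l • x)‖ₑ) ≤
      ENNReal.ofReal (l ^ (-(d / q + β)) * 16 ^ |β|) * V := by
    rw [setLp_comp_smul hl hq0 (1 / 4) 16 (fun x => ‖u x‖ₑ)]
    have h2 : setLp A q (fun x => ‖u x‖ₑ) ≤ ENNReal.ofReal (l ^ (-β) * 16 ^ |β|) * V := by
      refine setLp_le_mul hAm hq0 ENNReal.ofReal_ne_top fun x hx => ?_
      rw [enorm_mul, ENNReal.ofReal_mul (by positivity)]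
      calc ‖u x‖ₑ = (ENNReal.ofReal (l ^ (-β)) * ENNReal.ofReal (l ^ β)) * ‖u x‖ₑ := by
            rw [hinv, one_mul]
        _ ≤ (ENNReal.ofReal (l ^ (-β)) *
              (ENNReal.ofReal (16 ^ |β|) * ‖‖x‖ ^ β‖ₑ)) * ‖u x‖ₑ := by
            gcongr
            exact (hweight β x hx).1
        _ = _ := by ring
    calc _ ≤ ENNReal.ofReal (l ^ (-(d / q))) *
          (ENNReal.ofReal (l ^ (-β) * 16 ^ |β|) * V) := by gcongr
      _ = _ := by
        rw [← mul_assoc, ← ENNReal.ofReal_mul (by positivity)]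
        congr 2
        rw [show -(d / q + β) = -(d / q) + -β by ring, Real.rpow_add hl]
        ring
  -- the increment
  have hZ : setLp (closedAnnulus d (l * 1) (l * 2)) τ
        (fun x => ‖‖x‖ ^ γ * (u ((2 : ℝ) • x) - u x)‖ₑ) ≤
      ENNReal.ofReal (16 ^ |γ| * l ^ γ * l ^ (d / τ)) * setLp (closedAnnulus d 1 2) τ
        (fun x => ‖u (l • (2 : ℝ) • x) - u (l • x)‖ₑ) := by
    have e1 : ∀ x : EuclideanSpace ℝ (Fin d), l • (2 : ℝ) • x = (2 : ℝ) • l • x :=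
      fun x => smul_comm _ _ _
    simp_rw [e1]
    rw [setLp_comp_smul hl hτ0 1 2 (fun x => ‖u ((2 : ℝ) • x) - u x‖ₑ), ← mul_assoc,
      ← ENNReal.ofReal_mul (by positivity), mul_assoc (16 ^ |γ| * l ^ γ), ← Real.rpow_add hl,
      add_neg_cancel, Real.rpow_zero, mul_one (16 ^ |γ| * l ^ γ)]
    refine setLp_le_mul (isClosed_closedAnnulus _ _).measurableSet hτ0 ENNReal.ofReal_ne_top
      fun x hx => ?_
    rw [enorm_mul]
    gcongr
    refine (hweight γ x ?_).2
    exact closedAnnulus_subset (by linarith) (by linarith) hx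
  calc _ ≤ _ := hZ
    _ ≤ ENNReal.ofReal (16 ^ |γ| * l ^ γ * l ^ (d / τ)) *
        (C * ((ENNReal.ofReal (l ^ (-(d / p + α - 1)) * 16 ^ |α|) * U) ^ a *
          (ENNReal.ofReal (l ^ (-(d / q + β)) * 16 ^ |β|) * V) ^ (1 - a))) := by
        refine mul_le_mul_right (h1.trans (mul_le_mul_right (mul_le_mul' ?_ ?_) _)) _
        · exact ENNReal.rpow_le_rpow hU ha0.le
        · exact ENNReal.rpow_le_rpow hV (by linarith)
    _ = _ := by
        rw [ENNReal.mul_rpow_of_nonneg _ _ ha0.le,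
          ENNReal.mul_rpow_of_nonneg _ _ (by linarith : 0 ≤ 1 - a),
          ENNReal.ofReal_rpow_of_pos (by positivity), ENNReal.ofReal_rpow_of_pos (by positivity)]
        have e2 : 16 ^ |γ| * l ^ γ * l ^ (d / τ) * ((l ^ (-(d / p + α - 1)) * 16 ^ |α|) ^ a *
            (l ^ (-(d / q + β)) * 16 ^ |β|) ^ (1 - a)) =
            16 ^ |γ| * ((16 ^ |α|) ^ a * (16 ^ |β|) ^ (1 - a)) *
            l ^ (d / τ + γ - a * (d / p + α - 1) - (1 - a) * (d / q + β)) := by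
          rw [Real.mul_rpow (by positivity) (by positivity),
            Real.mul_rpow (by positivity) (by positivity), ← Real.rpow_mul hl.le,
            ← Real.rpow_mul hl.le,
            show d / τ + γ - a * (d / p + α - 1) - (1 - a) * (d / q + β) =
              γ + d / τ + -(d / p + α - 1) * a + -(d / q + β) * (1 - a) by ring,
            Real.rpow_add hl, Real.rpow_add hl, Real.rpow_add hl]
          ring
        have e3 := congrArg ENNReal.ofReal e2
        rw [ENNReal.ofReal_mul (by positivity : 0 ≤ 16 ^ |γ| * l ^ γ * l ^ (d / τ)),
          ENNReal.ofReal_mul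
            (by positivity : 0 ≤ (l ^ (-(d / p + α - 1)) * 16 ^ |α|) ^ a)] at e3
        rw [mul_assoc C, ← ENNReal.ofReal_mul (by positivity), ← e3]
        ring

/-! ### Dyadic decomposition and discrete inequalities -/

/-- The dyadic shell `{2 ^ k ≤ ‖x‖ < 2 ^ (k + 1)}`. -/
def dyadicShell (d : ℕ) (k : ℤ) : Set (EuclideanSpace ℝ (Fin d)) :=
  {x | (2 : ℝ) ^ k ≤ ‖x‖ ∧ ‖x‖ < 2 ^ (k + 1)}

theorem measurableSet_dyadicShell {d : ℕ} (k : ℤ) : MeasurableSet (dyadicShell d k) :=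
  (measurableSet_le measurable_const measurable_norm).inter
    (measurableSet_lt measurable_norm measurable_const)

theorem iUnion_dyadicShell {d : ℕ} : ⋃ k, dyadicShell d k = {0}ᶜ := by
  ext x
  rw [Set.mem_iUnion, Set.mem_compl_singleton_iff]
  constructor
  · rintro ⟨k, hk⟩ rfl
    have h1 : (0 : ℝ) < 2 ^ k := by positivity
    have h2 := hk.1
    rw [norm_zero] at h2
    linarith
  · intro hx
    obtain ⟨k, hk⟩ := exists_mem_Ico_zpow (norm_pos_iff.2 hx) (one_lt_two (α := ℝ))
    exact ⟨k, hk⟩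

theorem pairwise_disjoint_dyadicShell {d : ℕ} :
    Pairwise (Function.onFun Disjoint (dyadicShell d)) := by
  intro j k hjk
  rw [Function.onFun, Set.disjoint_left]
  intro x hj hk
  apply hjk
  have h1 := (zpow_lt_zpow_iff_right₀ (one_lt_two (α := ℝ))).1 (hj.1.trans_lt hk.2)
  have h2 := (zpow_lt_zpow_iff_right₀ (one_lt_two (α := ℝ))).1 (hk.1.trans_lt hj.2)
  omega

theorem tsum_setLIntegral_dyadicShell {d : ℕ} (hd : 1 ≤ d)
    (F : EuclideanSpace ℝ (Fin d) → ℝ≥0∞) :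
    ∑' k, ∫⁻ x in dyadicShell d k, F x = ∫⁻ x, F x := by
  have : Nonempty (Fin d) := ⟨⟨0, hd⟩⟩
  rw [← lintegral_iUnion measurableSet_dyadicShell pairwise_disjoint_dyadicShell,
    iUnion_dyadicShell]
  rw [restrict_compl_singleton]

/-- The indices run from k - 2 to k + 4. The last shell is needed because the annulus contains its
outer sphere while shells are open outside. -/
theorem closedAnnulus_subset_iUnion_dyadicShell {d : ℕ} (k : ℤ) :
    closedAnnulus d ((2 : ℝ) ^ k * (1 / 4)) (2 ^ k * 16) ⊆
      ⋃ i ∈ Finset.range 7, dyadicShell d (k + ((i : ℤ) - 2)) := by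
  intro x hx
  have h0 : (0 : ℝ) < 2 ^ k := by positivity
  have hx0 : x ≠ 0 := by
    rintro rfl
    have := hx.1
    rw [norm_zero] at this
    linarith
  obtain ⟨j, hj⟩ := exists_mem_Ico_zpow (norm_pos_iff.2 hx0) (one_lt_two (α := ℝ))
  have e1 : (2 : ℝ) ^ k * (1 / 4) = 2 ^ (k - 2) := by
    rw [zpow_sub₀ (by norm_num)]; norm_num; ring
  have e2 : (2 : ℝ) ^ k * 16 = 2 ^ (k + 4) := by
    rw [zpow_add₀ (by norm_num)]; norm_num
  have h1 : (2 : ℝ) ^ (k - 2) < 2 ^ (j + 1) := by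
    rw [← e1]; exact hx.1.trans_lt hj.2
  have h2 : (2 : ℝ) ^ j ≤ 2 ^ (k + 4) := by
    rw [← e2]; exact hj.1.trans hx.2
  have h3 := (zpow_lt_zpow_iff_right₀ (one_lt_two (α := ℝ))).1 h1
  have h4 := (zpow_le_zpow_iff_right₀ (one_lt_two (α := ℝ))).1 h2
  rw [Set.mem_iUnion₂]
  refine ⟨(j - k + 2).toNat, by rw [Finset.mem_range]; omega, ?_⟩
  have e3 : k + (((j - k + 2).toNat : ℤ) - 2) = j := by omega
  rw [e3]
  exact hj

/-- The enlarged dyadic annuli overlap boundedly. -/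
theorem tsum_setLIntegral_closedAnnulus_le {d : ℕ} (hd : 1 ≤ d)
    (F : EuclideanSpace ℝ (Fin d) → ℝ≥0∞) :
    ∑' k : ℤ, ∫⁻ x in closedAnnulus d ((2 : ℝ) ^ k * (1 / 4)) (2 ^ k * 16), F x ≤
      7 * ∫⁻ x, F x := by
  calc _ ≤ ∑' k : ℤ, ∑ i ∈ Finset.range 7, ∫⁻ x in dyadicShell d (k + ((i : ℤ) - 2)), F x := by
        refine ENNReal.tsum_le_tsum fun k => ?_
        refine (lintegral_mono_set (closedAnnulus_subset_iUnion_dyadicShell k)).trans (le_of_eq ?_)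
        refine lintegral_biUnion_finset (fun i _ j _ hij => ?_)
          (fun i _ => measurableSet_dyadicShell _) F
        exact pairwise_disjoint_dyadicShell (by omega)
    _ = ∑ i ∈ Finset.range 7, ∑' k : ℤ, ∫⁻ x in dyadicShell d (k + ((i : ℤ) - 2)), F x :=
        Summable.tsum_finsetSum fun _ _ => ENNReal.summable
    _ = ∑ i ∈ Finset.range 7, ∫⁻ x, F x := by
        refine Finset.sum_congr rfl fun i _ => ?_
        rw [← tsum_setLIntegral_dyadicShell hd F]
        exact (Equiv.addRight ((i : ℤ) - 2)).tsum_eq fun k => ∫⁻ x in dyadicShell d k, F x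
    _ = _ := by simp

/-- Hölder's inequality for sums, with weights of total mass at least one. -/
theorem tsum_rpow_mul_rpow_le (X Y : ℤ → ℝ≥0∞) {x y : ℝ} (hx : 0 ≤ x) (hy : 0 ≤ y)
    (hxy : 1 ≤ x + y) :
    ∑' k, X k ^ x * Y k ^ y ≤ (∑' k, X k) ^ x * (∑' k, Y k) ^ y := by
  set t := x + y with ht
  have ht0 : 0 < t := by linarith
  have hx' : 0 ≤ x / t := by positivity
  have hy' : 0 ≤ y / t := by positivity
  have h1 : ∑' k, X k ^ (x / t) * Y k ^ (y / t) ≤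
      (∑' k, X k) ^ (x / t) * (∑' k, Y k) ^ (y / t) := by
    simp_rw [← lintegral_count]
    exact ENNReal.lintegral_mul_norm_pow_le (measurable_of_countable _).aemeasurable
      (measurable_of_countable _).aemeasurable hx' hy' (by rw [← add_div, ht, div_self]; linarith)
  have e : ∀ A B : ℝ≥0∞, A ^ x * B ^ y = (A ^ (x / t) * B ^ (y / t)) ^ t := by
    intro A B
    rw [ENNReal.mul_rpow_of_nonneg _ _ ht0.le, ← ENNReal.rpow_mul, ← ENNReal.rpow_mul,
      div_mul_cancel₀ _ ht0.ne', div_mul_cancel₀ _ ht0.ne']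
  simp_rw [e]
  set b : ℤ → ℝ≥0∞ := fun k => X k ^ (x / t) * Y k ^ (y / t) with hb
  have e2 : ∀ c : ℝ≥0∞, c ^ t = c * c ^ (t - 1) := by
    intro c
    calc c ^ t = c ^ (1 + (t - 1)) := by ring_nf
      _ = _ := by rw [ENNReal.rpow_add_of_nonneg _ _ zero_le_one (by linarith), ENNReal.rpow_one]
  -- The embedding of ℓ^1 in ℓ^t for t ≥ 1: one factor of each term is kept and the others are
  -- bounded by the whole sum.
  calc ∑' k, b k ^ t ≤ ∑' k, b k * (∑' j, b j) ^ (t - 1) := by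
        refine ENNReal.tsum_le_tsum fun k => ?_
        rw [e2]
        exact mul_le_mul_right (ENNReal.rpow_le_rpow (ENNReal.le_tsum k) (by linarith)) _
    _ = (∑' k, b k) ^ t := by rw [ENNReal.tsum_mul_right, ← e2]
    _ ≤ _ := ENNReal.rpow_le_rpow h1 ht0.le

/-- A two-sided geometric sum is bounded independently of its position. -/
theorem exists_tsum_min_rpow_le {c : ℝ} (hc0 : 0 < c) (hc1 : c ≠ 1) {τ : ℝ} (hτ : 0 < τ) :
    ∃ K : ℝ≥0∞, K ≠ ⊤ ∧ ∀ ρ : ℝ, 0 < ρ →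
      ∑' k : ℤ, ENNReal.ofReal (min (c ^ k * ρ) (c ^ k * ρ)⁻¹) ^ τ ≤ K := by
  -- Replacing c by its inverse and k by -k leaves the form of the sum unchanged.
  wlog hc : 1 < c generalizing c
  · obtain ⟨K, hK, h⟩ := this (inv_pos.2 hc0) (by simpa using hc1)
      ((one_lt_inv₀ hc0).2 (lt_of_le_of_ne (not_lt.1 hc) hc1))
    refine ⟨K, hK, fun ρ hρ => ?_⟩
    rw [← (Equiv.neg ℤ).tsum_eq]
    simpa [inv_zpow] using h ρ hρ
  set r : ℝ≥0∞ := ENNReal.ofReal (c⁻¹ ^ τ) with hr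
  have hr1 : r < 1 := by
    rw [hr, ENNReal.ofReal_lt_one]
    exact Real.rpow_lt_one (by positivity) (inv_lt_one_of_one_lt₀ hc) hτ
  set G : ℤ → ℝ≥0∞ := fun m => ENNReal.ofReal (c * min (c ^ m) (c ^ m)⁻¹) ^ τ with hG
  refine ⟨2 * (ENNReal.ofReal (c ^ τ) * (1 - r)⁻¹), ?_, fun ρ hρ => ?_⟩
  · refine ENNReal.mul_ne_top (by simp) (ENNReal.mul_ne_top ENNReal.ofReal_ne_top ?_)
    exact ENNReal.inv_ne_top.2 (tsub_pos_of_lt hr1).ne'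
  -- With c^n ≤ ρ < c^(n+1), the shift k ↦ k + n reduces to ρ = 1 at the cost of the factor c in G.
  obtain ⟨n, hn1, hn2⟩ := exists_mem_Ico_zpow hρ hc
  have hpow : ∀ j : ℕ, ENNReal.ofReal (c * c⁻¹ ^ j) ^ τ = ENNReal.ofReal (c ^ τ) * r ^ j := by
    intro j
    rw [hr, ENNReal.ofReal_rpow_of_pos (by positivity), ← ENNReal.ofReal_pow (by positivity),
      ← ENNReal.ofReal_mul (by positivity), Real.mul_rpow (by positivity) (by positivity),
      ← Real.rpow_natCast, ← Real.rpow_natCast, ← Real.rpow_mul (by positivity),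
      ← Real.rpow_mul (by positivity), mul_comm τ]
  have hnat : ∀ j : ℕ, G j ≤ ENNReal.ofReal (c ^ τ) * r ^ j := by
    intro j
    rw [← hpow, hG]
    refine ENNReal.rpow_le_rpow (ENNReal.ofReal_le_ofReal ?_) hτ.le
    gcongr
    refine (min_le_right _ _).trans (le_of_eq ?_)
    rw [zpow_natCast, inv_pow]
  have hneg : ∀ j : ℕ, G (-(j + 1 : ℤ)) ≤ ENNReal.ofReal (c ^ τ) * r ^ j := by
    intro j
    rw [← hpow, hG]
    refine ENNReal.rpow_le_rpow (ENNReal.ofReal_le_ofReal ?_) hτ.le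
    gcongr
    refine (min_le_left _ _).trans ?_
    rw [zpow_neg, ← inv_zpow, ← Nat.cast_succ, zpow_natCast]
    exact pow_le_pow_of_le_one (by positivity) (inv_le_one_of_one_le₀ hc.le) (Nat.le_succ j)
  calc ∑' k : ℤ, ENNReal.ofReal (min (c ^ k * ρ) (c ^ k * ρ)⁻¹) ^ τ
      ≤ ∑' k : ℤ, G (k + n) := by
        refine ENNReal.tsum_le_tsum fun k => ?_
        refine ENNReal.rpow_le_rpow (ENNReal.ofReal_le_ofReal ?_) hτ.le
        have hck : 0 < c ^ k := by positivity
        have hcn : 0 < c ^ n := by positivity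
        rw [zpow_add₀ hc0.ne', mul_min_of_nonneg _ _ hc0.le]
        refine min_le_min ?_ ?_
        · rw [zpow_add₀ hc0.ne', zpow_one] at hn2
          calc c ^ k * ρ ≤ c ^ k * (c ^ n * c) := by gcongr
            _ = _ := by ring
        · calc (c ^ k * ρ)⁻¹ ≤ (c ^ k * c ^ n)⁻¹ := by gcongr
            _ ≤ _ := le_mul_of_one_le_left (by positivity) hc.le
    _ = ∑' k : ℤ, G k := (Equiv.addRight n).tsum_eq G
    _ = ∑' j : ℕ, G j + ∑' j : ℕ, G (-(j + 1 : ℤ)) :=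
        tsum_of_nat_of_neg_add_one ENNReal.summable ENNReal.summable
    _ ≤ ∑' j : ℕ, ENNReal.ofReal (c ^ τ) * r ^ j + ∑' j : ℕ, ENNReal.ofReal (c ^ τ) * r ^ j :=
        add_le_add (ENNReal.tsum_le_tsum hnat) (ENNReal.tsum_le_tsum hneg)
    _ = _ := by rw [ENNReal.tsum_mul_left, ENNReal.tsum_geometric, two_mul]

theorem setLp_rpow {d : ℕ} (S : Set (EuclideanSpace ℝ (Fin d))) {p : ℝ} (hp : 0 < p)
    (f : EuclideanSpace ℝ (Fin d) → ℝ≥0∞) : setLp S p f ^ p = ∫⁻ x in S, f x ^ p := by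
  rw [setLp, ← ENNReal.rpow_mul, one_div_mul_cancel hp.ne', ENNReal.rpow_one]

theorem setLp_univ_eq_tsum {d : ℕ} (hd : 1 ≤ d) (p : ℝ)
    (f : EuclideanSpace ℝ (Fin d) → ℝ≥0∞) :
    setLp Set.univ p f = (∑' k, ∫⁻ x in dyadicShell d k, f x ^ p) ^ (1 / p) := by
  rw [tsum_setLIntegral_dyadicShell hd, setLp, setLIntegral_univ]

theorem setLIntegral_dyadicShell_le {d : ℕ} (k : ℤ) {p : ℝ} (hp : 0 < p)
    (f : EuclideanSpace ℝ (Fin d) → ℝ≥0∞) :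
    ∫⁻ x in dyadicShell d k, f x ^ p ≤
      setLp (closedAnnulus d ((2 : ℝ) ^ k * 1) (2 ^ k * 2)) p f ^ p := by
  rw [setLp_rpow _ hp]
  refine lintegral_mono_set fun x hx => ⟨by rw [mul_one]; exact hx.1, ?_⟩
  have h := hx.2.le
  rwa [zpow_add₀ (by norm_num), zpow_one] at h

/-! ### The weighted inequality for the dyadic increment -/

/-- The weighted Gagliardo–Nirenberg inequality for the dyadic increment when `α - σ ≤ 1`. -/
theorem exists_setLp_sub_le_of_le {d : ℕ} (hd : 1 ≤ d) {p q τ a α β γ : ℝ}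
    (hp : 1 ≤ p) (hq : 1 ≤ q) (hτ : 1 ≤ τ) (ha0 : 0 < a) (ha1 : a ≤ 1)
    (h : a * (1 / p - 1 / d) + (1 - a) * (1 / q) ≤ 1 / τ)
    (h' : 1 / τ ≤ a * (1 / p) + (1 - a) * (1 / q))
    (hbal : d / τ + γ = a * (d / p + α - 1) + (1 - a) * (d / q + β)) :
    ∃ C : ℝ≥0∞, C ≠ ⊤ ∧ ∀ (u : EuclideanSpace ℝ (Fin d) → ℝ)
      (g : EuclideanSpace ℝ (Fin d) → EuclideanSpace ℝ (Fin d)), LocallyIntegrableOn u {0}ᶜ →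
      IsWeakGradientPunctured u g →
      setLp Set.univ τ (fun x => ‖‖x‖ ^ γ * (u ((2 : ℝ) • x) - u x)‖ₑ) ≤
        C * (setLp Set.univ p (fun x => ‖‖x‖ ^ α • g x‖ₑ) ^ a *
          setLp Set.univ q (fun x => ‖‖x‖ ^ β * u x‖ₑ) ^ (1 - a)) := by
  have hp0 : 0 < p := by linarith
  have hq0 : 0 < q := by linarith
  have hτ0 : 0 < τ := by linarith
  have hx : 0 ≤ a * τ / p := by positivity
  have hy : 0 ≤ (1 - a) * τ / q := div_nonneg (mul_nonneg (by linarith) hτ0.le) hq0.le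
  -- This is `h'`, the form taken by α - σ ≤ 1; it allows Hölder's inequality for the sum over
  -- shells.
  have hxy : 1 ≤ a * τ / p + (1 - a) * τ / q := by
    have h1 : τ * (1 / τ) ≤ τ * (a * (1 / p) + (1 - a) * (1 / q)) := by gcongr
    rw [mul_one_div_cancel hτ0.ne'] at h1
    calc (1 : ℝ) ≤ _ := h1
      _ = _ := by ring
  obtain ⟨C, hC, hS⟩ := exists_setLp_closedAnnulus_sub_le hd α β γ hp hq hτ ha0 ha1 h
  refine ⟨C * (7 ^ (a / p) * 7 ^ ((1 - a) / q)), ?_, ?_⟩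
  · refine ENNReal.mul_ne_top hC (ENNReal.mul_ne_top ?_ ?_)
    · exact ENNReal.rpow_ne_top_of_nonneg (by positivity) (by simp)
    · exact ENNReal.rpow_ne_top_of_nonneg (div_nonneg (by linarith) hq0.le) (by simp)
  intro u g hu hg
  set G : EuclideanSpace ℝ (Fin d) → ℝ≥0∞ := fun x => ‖‖x‖ ^ α • g x‖ₑ
  set W : EuclideanSpace ℝ (Fin d) → ℝ≥0∞ := fun x => ‖‖x‖ ^ β * u x‖ₑ
  set X : ℤ → ℝ≥0∞ := fun k =>
    ∫⁻ x in closedAnnulus d ((2 : ℝ) ^ k * (1 / 4)) (2 ^ k * 16), G x ^ p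
  set Y : ℤ → ℝ≥0∞ := fun k =>
    ∫⁻ x in closedAnnulus d ((2 : ℝ) ^ k * (1 / 4)) (2 ^ k * 16), W x ^ q
  have hXs : ∑' k, X k ≤ 7 * ∫⁻ x, G x ^ p := tsum_setLIntegral_closedAnnulus_le hd _
  have hYs : ∑' k, Y k ≤ 7 * ∫⁻ x, W x ^ q := tsum_setLIntegral_closedAnnulus_le hd _
  have hk : ∀ k : ℤ, ∫⁻ x in dyadicShell d k, ‖‖x‖ ^ γ * (u ((2 : ℝ) • x) - u x)‖ₑ ^ τ ≤
      C ^ τ * (X k ^ (a * τ / p) * Y k ^ ((1 - a) * τ / q)) := by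
    intro k
    refine (setLIntegral_dyadicShell_le k hτ0
      (fun x => ‖‖x‖ ^ γ * (u ((2 : ℝ) • x) - u x)‖ₑ)).trans ?_
    have h1 := hS u g hu hg (2 ^ k) (by positivity)
    rw [show d / τ + γ - a * (d / p + α - 1) - (1 - a) * (d / q + β) = 0 by linarith,
      Real.rpow_zero, ENNReal.ofReal_one, mul_one C] at h1
    refine (ENNReal.rpow_le_rpow h1 hτ0.le).trans (le_of_eq ?_)
    rw [ENNReal.mul_rpow_of_nonneg _ _ hτ0.le, ENNReal.mul_rpow_of_nonneg _ _ hτ0.le, setLp, setLp,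
      ← ENNReal.rpow_mul, ← ENNReal.rpow_mul, ← ENNReal.rpow_mul, ← ENNReal.rpow_mul]
    congr 3
    · ring
    · ring
  rw [setLp_univ_eq_tsum hd]
  calc (∑' k, ∫⁻ x in dyadicShell d k, ‖‖x‖ ^ γ * (u ((2 : ℝ) • x) - u x)‖ₑ ^ τ) ^ (1 / τ)
      ≤ (C ^ τ * ((7 * ∫⁻ x, G x ^ p) ^ (a * τ / p) *
          (7 * ∫⁻ x, W x ^ q) ^ ((1 - a) * τ / q))) ^ (1 / τ) := by
        refine ENNReal.rpow_le_rpow ?_ (by positivity)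
        refine (ENNReal.tsum_le_tsum hk).trans ?_
        rw [ENNReal.tsum_mul_left]
        refine mul_le_mul_right ((tsum_rpow_mul_rpow_le X Y hx hy hxy).trans (mul_le_mul' ?_ ?_)) _
        · exact ENNReal.rpow_le_rpow hXs hx
        · exact ENNReal.rpow_le_rpow hYs hy
    _ = _ := by
        rw [setLp, setLp, setLIntegral_univ, setLIntegral_univ]
        have h1a : 0 ≤ (1 - a) / q := div_nonneg (by linarith) hq0.le
        rw [ENNReal.mul_rpow_of_nonneg _ _ (by positivity : 0 ≤ 1 / τ),
          ENNReal.mul_rpow_of_nonneg _ _ (by positivity : 0 ≤ 1 / τ), ← ENNReal.rpow_mul,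
          ← ENNReal.rpow_mul, ← ENNReal.rpow_mul, ← ENNReal.rpow_mul, ← ENNReal.rpow_mul,
          mul_one_div_cancel hτ0.ne', ENNReal.rpow_one,
          show a * τ / p * (1 / τ) = a / p by field_simp,
          show (1 - a) * τ / q * (1 / τ) = (1 - a) / q by field_simp,
          ENNReal.mul_rpow_of_nonneg _ _ (by positivity), ENNReal.mul_rpow_of_nonneg _ _ h1a,
          show 1 / p * a = a / p by ring, show 1 / q * (1 - a) = (1 - a) / q by ring]
        ring

/-- The weighted Gagliardo–Nirenberg inequality for the dyadic increment when `0 < α - σ` and the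
scaling dimensions of the two norms on the right differ. -/
theorem exists_setLp_sub_le_of_lt {d : ℕ} (hd : 1 ≤ d) {p q τ a α β γ : ℝ}
    (hp : 1 ≤ p) (hq : 1 ≤ q) (hτ : 1 ≤ τ) (ha0 : 0 < a) (ha1 : a < 1)
    (h : a * (1 / p - 1 / d) + (1 - a) * (1 / q) < 1 / τ)
    (hne : d / p + α - 1 ≠ d / q + β)
    (hbal : d / τ + γ = a * (d / p + α - 1) + (1 - a) * (d / q + β)) :
    ∃ C : ℝ≥0∞, C ≠ ⊤ ∧ ∀ (u : EuclideanSpace ℝ (Fin d) → ℝ)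
      (g : EuclideanSpace ℝ (Fin d) → EuclideanSpace ℝ (Fin d)), LocallyIntegrableOn u {0}ᶜ →
      IsWeakGradientPunctured u g →
      setLp Set.univ τ (fun x => ‖‖x‖ ^ γ * (u ((2 : ℝ) • x) - u x)‖ₑ) ≤
        C * (setLp Set.univ p (fun x => ‖‖x‖ ^ α • g x‖ₑ) ^ a *
          setLp Set.univ q (fun x => ‖‖x‖ ^ β * u x‖ₑ) ^ (1 - a)) := by
  have hp0 : 0 < p := by linarith
  have hq0 : 0 < q := by linarith
  have hτ0 : 0 < τ := by linarith
  set m : ℝ := 1 / p - 1 / d - 1 / q with hm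
  set δ : ℝ := 1 / τ - (a * (1 / p - 1 / d) + (1 - a) * (1 / q)) with hδ
  have hδ0 : 0 < δ := by linarith
  -- The number m is the slope in a of the subcritical bound and δ is its slack, so the bound
  -- survives replacing a by a ± ε when ε|m| ≤ δ.
  obtain ⟨ε, hε0, hεa, hε1, hεm⟩ : ∃ ε : ℝ, 0 < ε ∧ ε < a ∧ ε < 1 - a ∧ ε * |m| ≤ δ := by
    refine ⟨min (a / 2) (min ((1 - a) / 2) (δ / (|m| + 1))), ?_, ?_, ?_, ?_⟩
    · have : 0 < (1 - a) / 2 := by linarith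
      positivity
    · exact (min_le_left _ _).trans_lt (by linarith)
    · exact ((min_le_right _ _).trans (min_le_left _ _)).trans_lt (by linarith)
    · calc _ ≤ δ / (|m| + 1) * |m| := by
            gcongr
            exact (min_le_right _ _).trans (min_le_right _ _)
        _ ≤ δ := by
            rw [div_mul_eq_mul_div, div_le_iff₀ (by positivity)]
            nlinarith [abs_nonneg m]
  have hm1 := le_abs_self m
  have hm2 := neg_abs_le m
  obtain ⟨C₁, hC₁, hS₁⟩ := exists_setLp_closedAnnulus_sub_le hd α β γ hp hq hτ
    (a := a + ε) (by linarith) (by linarith) (by nlinarith)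
  obtain ⟨C₂, hC₂, hS₂⟩ := exists_setLp_closedAnnulus_sub_le hd α β γ hp hq hτ
    (a := a - ε) (by linarith) (by linarith) (by nlinarith)
  set Δ : ℝ := (d / p + α - 1) - (d / q + β) with hΔ
  have hΔ0 : Δ ≠ 0 := sub_ne_zero.2 hne
  -- At scale 2^k the bounds with a + ε and a - ε carry the factors c^k and c^(-k). Since Δ ≠ 0, one
  -- decays in each direction of k.
  set c : ℝ := 2 ^ (-(ε * Δ)) with hc
  have hc0 : 0 < c := by positivity
  have hc1 : c ≠ 1 := by
    rcases (neg_ne_zero.2 (mul_ne_zero hε0.ne' hΔ0)).lt_or_gt with h1 | h1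
    · exact (Real.rpow_lt_one_of_one_lt_of_neg one_lt_two h1).ne
    · exact (Real.one_lt_rpow one_lt_two h1).ne'
  obtain ⟨K, hK, hKs⟩ := exists_tsum_min_rpow_le hc0 hc1 hτ0
  -- The added 1 keeps the constant nonzero, so that its product with an infinite right side is
  -- infinite.
  refine ⟨(C₁ + C₂) * K ^ (1 / τ) + 1, ENNReal.add_ne_top.2 ⟨ENNReal.mul_ne_top (ENNReal.add_ne_top.2 ⟨hC₁, hC₂⟩)
    (ENNReal.rpow_ne_top_of_nonneg (by positivity) hK), ENNReal.one_ne_top⟩, ?_⟩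
  intro u g hu hg
  set f : EuclideanSpace ℝ (Fin d) → ℝ≥0∞ := fun x => ‖‖x‖ ^ γ * (u ((2 : ℝ) • x) - u x)‖ₑ
  set U := setLp Set.univ p (fun x => ‖‖x‖ ^ α • g x‖ₑ) with hU
  set V := setLp Set.univ q (fun x => ‖‖x‖ ^ β * u x‖ₑ) with hV
  have hpow : ∀ (k : ℤ) (t : ℝ), ((2 : ℝ) ^ k) ^ t = (2 ^ t) ^ k := by
    intro k t
    rw [← Real.rpow_intCast, ← Real.rpow_intCast, ← Real.rpow_mul (by norm_num),
      ← Real.rpow_mul (by norm_num), mul_comm]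
  have hk₁ : ∀ k : ℤ, setLp (closedAnnulus d ((2 : ℝ) ^ k * 1) (2 ^ k * 2)) τ f ≤
      C₁ * ENNReal.ofReal (c ^ k) * (U ^ (a + ε) * V ^ (1 - (a + ε))) := by
    intro k
    have h1 := hS₁ u g hu hg (2 ^ k) (by positivity)
    rw [show d / τ + γ - (a + ε) * (d / p + α - 1) - (1 - (a + ε)) * (d / q + β) = -(ε * Δ) by
      rw [hbal, hΔ]; ring, hpow] at h1
    refine h1.trans (mul_le_mul_right (mul_le_mul' ?_ ?_) _)
    · exact ENNReal.rpow_le_rpow (setLp_mono_set (Set.subset_univ _) hp0 _) (by linarith)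
    · exact ENNReal.rpow_le_rpow (setLp_mono_set (Set.subset_univ _) hq0 _) (by linarith)
  have hk₂ : ∀ k : ℤ, setLp (closedAnnulus d ((2 : ℝ) ^ k * 1) (2 ^ k * 2)) τ f ≤
      C₂ * ENNReal.ofReal (c ^ k)⁻¹ * (U ^ (a - ε) * V ^ (1 - (a - ε))) := by
    intro k
    have h1 := hS₂ u g hu hg (2 ^ k) (by positivity)
    rw [show d / τ + γ - (a - ε) * (d / p + α - 1) - (1 - (a - ε)) * (d / q + β) = ε * Δ by
      rw [hbal, hΔ]; ring, hpow] at h1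
    have h2 : ((2 : ℝ) ^ (ε * Δ)) ^ k = (c ^ k)⁻¹ := by
      rw [hc, Real.rpow_neg (by norm_num), inv_zpow, inv_inv]
    rw [h2] at h1
    refine h1.trans (mul_le_mul_right (mul_le_mul' ?_ ?_) _)
    · exact ENNReal.rpow_le_rpow (setLp_mono_set (Set.subset_univ _) hp0 _) (by linarith)
    · exact ENNReal.rpow_le_rpow (setLp_mono_set (Set.subset_univ _) hq0 _) (by linarith)
  -- Both exponents in the bound with a + ε are positive, so a zero factor kills every shell, even
  -- when the other factor is infinite.
  by_cases h0 : U = 0 ∨ V = 0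
  · have h1 : U ^ (a + ε) * V ^ (1 - (a + ε)) = 0 := by
      rcases h0 with h0 | h0
      · rw [h0, ENNReal.zero_rpow_of_pos (by linarith), zero_mul]
      · rw [h0, ENNReal.zero_rpow_of_pos (by linarith), mul_zero]
    have h2 : ∀ k : ℤ, ∫⁻ x in dyadicShell d k, f x ^ τ = 0 := by
      intro k
      have h3 := hk₁ k
      rw [h1, mul_zero, nonpos_iff_eq_zero] at h3
      have h4 := setLIntegral_dyadicShell_le k hτ0 f
      rwa [h3, ENNReal.zero_rpow_of_pos hτ0, nonpos_iff_eq_zero] at h4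
    rw [setLp_univ_eq_tsum hd]
    simp only [h2, tsum_zero]
    rw [ENNReal.zero_rpow_of_pos (by positivity)]
    exact zero_le
  rw [not_or] at h0
  obtain ⟨hU0, hV0⟩ := h0
  by_cases htop : U = ⊤ ∨ V = ⊤
  · have h1 : U ^ a * V ^ (1 - a) = ⊤ := by
      rcases htop with h1 | h1
      · rw [h1, ENNReal.top_rpow_of_pos ha0, ENNReal.top_mul]
        exact fun h2 => by
          rcases ENNReal.rpow_eq_zero_iff.1 h2 with h2 | h2
          · exact hV0 h2.1
          · linarith
      · rw [h1, ENNReal.top_rpow_of_pos (by linarith), ENNReal.mul_top]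
        exact fun h2 => by
          rcases ENNReal.rpow_eq_zero_iff.1 h2 with h2 | h2
          · exact hU0 h2.1
          · linarith
    rw [h1, ENNReal.mul_top (by simp)]
    exact le_top
  rw [not_or] at htop
  obtain ⟨x, hx, hUx⟩ : ∃ x : ℝ, 0 < x ∧ U = ENNReal.ofReal x :=
    ⟨U.toReal, ENNReal.toReal_pos hU0 htop.1, (ENNReal.ofReal_toReal htop.1).symm⟩
  obtain ⟨y, hy, hVy⟩ : ∃ y : ℝ, 0 < y ∧ V = ENNReal.ofReal y :=
    ⟨V.toReal, ENNReal.toReal_pos hV0 htop.2, (ENNReal.ofReal_toReal htop.2).symm⟩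
  have hUV : ∀ t : ℝ, U ^ t * V ^ (1 - t) = ENNReal.ofReal (x ^ t * y ^ (1 - t)) := by
    intro t
    rw [hUx, hVy, ENNReal.ofReal_rpow_of_pos hx, ENNReal.ofReal_rpow_of_pos hy,
      ← ENNReal.ofReal_mul (by positivity)]
  -- Relative to M = U^a V^(1-a), the two bounds are c^k ρ and its inverse, up to constants. The sum
  -- of the minima is bounded independently of ρ.
  set ρ : ℝ := (x / y) ^ ε with hρ
  have hρ0 : 0 < ρ := by positivity
  have e₁ : x ^ (a + ε) * y ^ (1 - (a + ε)) = x ^ a * y ^ (1 - a) * ρ := by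
    rw [hρ, Real.rpow_add hx, show 1 - (a + ε) = 1 - a - ε by ring, Real.rpow_sub hy,
      Real.div_rpow hx.le hy.le]
    ring
  have e₂ : x ^ (a - ε) * y ^ (1 - (a - ε)) = x ^ a * y ^ (1 - a) * ρ⁻¹ := by
    rw [hρ, Real.rpow_sub hx, show 1 - (a - ε) = 1 - a + ε by ring, Real.rpow_add hy,
      Real.div_rpow hx.le hy.le]
    field_simp
  set M := U ^ a * V ^ (1 - a) with hM
  have hMx : M = ENNReal.ofReal (x ^ a * y ^ (1 - a)) := hUV a
  have hk : ∀ k : ℤ, ∫⁻ x in dyadicShell d k, f x ^ τ ≤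
      ((C₁ + C₂) * M) ^ τ * ENNReal.ofReal (min (c ^ k * ρ) (c ^ k * ρ)⁻¹) ^ τ := by
    intro k
    rw [← ENNReal.mul_rpow_of_nonneg _ _ hτ0.le]
    refine (setLIntegral_dyadicShell_le k hτ0 f).trans (ENNReal.rpow_le_rpow ?_ hτ0.le)
    rcases min_choice (c ^ k * ρ) (c ^ k * ρ)⁻¹ with h1 | h1
    · rw [h1]
      refine (hk₁ k).trans ?_
      rw [hUV, e₁, ENNReal.ofReal_mul (by positivity), ← hMx, ENNReal.ofReal_mul (by positivity)]
      calc _ = C₁ * M * (ENNReal.ofReal (c ^ k) * ENNReal.ofReal ρ) := by ring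
        _ ≤ _ := by gcongr; exact le_self_add
    · rw [h1, mul_inv]
      refine (hk₂ k).trans ?_
      rw [hUV, e₂, ENNReal.ofReal_mul (by positivity), ← hMx, ENNReal.ofReal_mul (by positivity)]
      calc _ = C₂ * M * (ENNReal.ofReal (c ^ k)⁻¹ * ENNReal.ofReal ρ⁻¹) := by ring
        _ ≤ _ := by gcongr; exact le_add_self
  rw [setLp_univ_eq_tsum hd]
  calc (∑' k, ∫⁻ x in dyadicShell d k, f x ^ τ) ^ (1 / τ)
      ≤ (((C₁ + C₂) * M) ^ τ * K) ^ (1 / τ) := by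
        refine ENNReal.rpow_le_rpow ?_ (by positivity)
        refine (ENNReal.tsum_le_tsum hk).trans ?_
        rw [ENNReal.tsum_mul_left]
        exact mul_le_mul_right (hKs ρ hρ0) _
    _ = (C₁ + C₂) * K ^ (1 / τ) * M := by
        rw [ENNReal.mul_rpow_of_nonneg _ _ (by positivity), ← ENNReal.rpow_mul,
          mul_one_div_cancel hτ0.ne', ENNReal.rpow_one]
        ring
    _ ≤ _ := by gcongr; exact le_self_add

/-- The weighted Gagliardo–Nirenberg inequality for the dyadic increment. -/
theorem exists_setLp_sub_le {d : ℕ} (hd : 1 ≤ d) {p q τ a α β γ σ : ℝ}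
    (hp : 1 ≤ p) (hq : 1 ≤ q) (hτ : 1 ≤ τ) (ha0 : 0 < a) (ha1 : a ≤ 1)
    (hσ : γ = a * σ + (1 - a) * β)
    (hbalance : 1 / τ + γ / d = a * (1 / p + (α - 1) / d) + (1 - a) * (1 / q + β / d))
    (hασ : 0 ≤ α - σ)
    (hborder : 1 / τ + γ / d = 1 / p + (α - 1) / d → α - σ ≤ 1) :
    ∃ C : ℝ≥0∞, C ≠ ⊤ ∧ ∀ (u : EuclideanSpace ℝ (Fin d) → ℝ)
      (g : EuclideanSpace ℝ (Fin d) → EuclideanSpace ℝ (Fin d)), LocallyIntegrableOn u {0}ᶜ →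
      IsWeakGradientPunctured u g →
      setLp Set.univ τ (fun x => ‖‖x‖ ^ γ * (u ((2 : ℝ) • x) - u x)‖ₑ) ≤
        C * (setLp Set.univ p (fun x => ‖‖x‖ ^ α • g x‖ₑ) ^ a *
          setLp Set.univ q (fun x => ‖‖x‖ ^ β * u x‖ₑ) ^ (1 - a)) := by
  have hd0 : (0 : ℝ) < d := by exact_mod_cast hd
  have e1 : d / p + α - 1 = d * (1 / p + (α - 1) / d) := by field_simp; ring
  have e2 : d / q + β = d * (1 / q + β / d) := by field_simp
  have e3 : d / τ + γ = d * (1 / τ + γ / d) := by field_simp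
  have hbal : d / τ + γ = a * (d / p + α - 1) + (1 - a) * (d / q + β) := by
    rw [e1, e2, e3, hbalance]; ring
  have hγ : γ / d = a * σ / d + (1 - a) * β / d := by rw [hσ]; ring
  -- The balance law solved for 1/τ: α - σ ≥ 0 gives the subcriticality condition, and α - σ ≤ 1
  -- gives the condition for summation.
  have hτeq : 1 / τ = a * (1 / p) + (1 - a) * (1 / q) + a * ((α - σ) / d - 1 / d) := by
    have h1 : a * (1 / p + (α - 1) / d) + (1 - a) * (1 / q + β / d) - (a * σ / d + (1 - a) * β / d)
      = a * (1 / p) + (1 - a) * (1 / q) + a * ((α - σ) / d - 1 / d) := by ring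
    linarith
  rcases le_or_gt (α - σ) 1 with hν | hν
  · refine exists_setLp_sub_le_of_le hd hp hq hτ ha0 ha1 ?_ ?_ hbal
    · have : 0 ≤ a * ((α - σ) / d) := by positivity
      rw [hτeq]; linarith
    · have : a * ((α - σ) / d - 1 / d) ≤ 0 := by
        refine mul_nonpos_of_nonneg_of_nonpos ha0.le (sub_nonpos.2 ?_)
        gcongr
      rw [hτeq]; linarith
  -- When α - σ > 1 the border hypothesis excludes this equality. Both a = 1 and equal scaling
  -- dimensions would force it through the balance law.
  · have hne : 1 / τ + γ / d ≠ 1 / p + (α - 1) / d := fun h => by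
      have := hborder h
      linarith
    have ha1' : a < 1 := by
      refine lt_of_le_of_ne ha1 fun h => hne ?_
      rw [hbalance, h]; ring
    refine exists_setLp_sub_le_of_lt hd hp hq hτ ha0 ha1' ?_ ?_ hbal
    · have : 0 < a * ((α - σ) / d) := by positivity
      rw [hτeq]; linarith
    · intro h
      rw [e1, e2] at h
      have h1 := mul_left_cancel₀ hd0.ne' h
      apply hne
      rw [hbalance, ← h1]; ring

/-! ### Recovering the function from its increment -/

/-- The factor is less than 1 for d/τ + γ > 0 and greater than 1 for d/τ + γ < 0; this decides from
which end u can be recovered. -/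
theorem setLp_preimage_smul_eq {d : ℕ} {τ : ℝ} (γ : ℝ) (hτ : 0 < τ)
    {T : Set (EuclideanSpace ℝ (Fin d))} (hT : MeasurableSet T)
    (u : EuclideanSpace ℝ (Fin d) → ℝ) :
    setLp ((fun x => (2 : ℝ) • x) ⁻¹' T) τ (fun x => ‖‖x‖ ^ γ * u ((2 : ℝ) • x)‖ₑ) =
      ENNReal.ofReal (2 ^ (-(d / τ + γ))) * setLp T τ (fun x => ‖‖x‖ ^ γ * u x‖ₑ) := by
  have e1 : ∀ x : EuclideanSpace ℝ (Fin d), ‖‖x‖ ^ γ * u ((2 : ℝ) • x)‖ₑ ^ τ =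
      ENNReal.ofReal (2 ^ (-γ * τ)) * ‖‖(2 : ℝ) • x‖ ^ γ * u ((2 : ℝ) • x)‖ₑ ^ τ := by
    intro x
    rw [Real.rpow_mul (by norm_num), ← ENNReal.ofReal_rpow_of_pos (by positivity),
      ← ENNReal.mul_rpow_of_nonneg _ _ hτ.le, enorm_mul, enorm_mul, ← mul_assoc,
      ← Real.enorm_of_nonneg (by positivity : (0 : ℝ) ≤ 2 ^ (-γ)), ← enorm_mul, norm_smul,
      Real.norm_of_nonneg (by norm_num), Real.mul_rpow (by norm_num) (norm_nonneg _), ← enorm_mul,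
      ← mul_assoc, ← Real.rpow_add (by norm_num)]
    simp
  rw [setLp, setLp]
  simp_rw [e1]
  rw [lintegral_const_mul' _ _ ENNReal.ofReal_ne_top,
    setLIntegral_comp_smul (by norm_num) hT (fun x => ‖‖x‖ ^ γ * u x‖ₑ ^ τ), ← mul_assoc,
    ← ENNReal.ofReal_mul (by positivity), ENNReal.mul_rpow_of_nonneg _ _ (by positivity),
    ENNReal.ofReal_rpow_of_pos (by positivity), ← Real.rpow_natCast, ← Real.rpow_neg (by norm_num),
    ← Real.rpow_add (by norm_num), ← Real.rpow_mul (by norm_num)]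
  congr 3
  field_simp
  ring

theorem aemeasurable_enorm_rpow_norm_mul {d : ℕ} {u : EuclideanSpace ℝ (Fin d) → ℝ}
    (hu : AEMeasurable u) (γ : ℝ) (S : Set (EuclideanSpace ℝ (Fin d))) :
    AEMeasurable (fun x => ‖‖x‖ ^ γ * u x‖ₑ) (volume.restrict S) :=
  (((measurable_norm.pow_const γ).aemeasurable.mul hu).enorm).restrict

theorem setLp_le_add {d : ℕ} {τ : ℝ} (hτ : 1 ≤ τ) {γ : ℝ} {u v : EuclideanSpace ℝ (Fin d) → ℝ}
    (hu : AEMeasurable u) (hv : AEMeasurable v) (S : Set (EuclideanSpace ℝ (Fin d))) :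
    setLp S τ (fun x => ‖‖x‖ ^ γ * u x‖ₑ) ≤
      setLp Set.univ τ (fun x => ‖‖x‖ ^ γ * (v x - u x)‖ₑ) +
        setLp S τ (fun x => ‖‖x‖ ^ γ * v x‖ₑ) := by
  have hτ0 : 0 < τ := by linarith
  calc setLp S τ (fun x => ‖‖x‖ ^ γ * u x‖ₑ)
      ≤ setLp S τ (fun x => ‖‖x‖ ^ γ * (v x - u x)‖ₑ + ‖‖x‖ ^ γ * v x‖ₑ) := by
        refine ENNReal.rpow_le_rpow (lintegral_mono fun x => ENNReal.rpow_le_rpow ?_ hτ0.le)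
          (by positivity)
        have e : ‖x‖ ^ γ * u x = ‖x‖ ^ γ * v x - ‖x‖ ^ γ * (v x - u x) := by ring
        exact (congrArg enorm e).le.trans (enorm_sub_le.trans_eq (add_comm _ _))
    _ ≤ setLp S τ (fun x => ‖‖x‖ ^ γ * (v x - u x)‖ₑ) + setLp S τ (fun x => ‖‖x‖ ^ γ * v x‖ₑ) :=
        ENNReal.lintegral_Lp_add_le (aemeasurable_enorm_rpow_norm_mul (hv.sub hu) γ S)
          (aemeasurable_enorm_rpow_norm_mul hv γ S) hτ
    _ ≤ _ := by gcongr; exact setLp_mono_set (Set.subset_univ _) hτ0 _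

theorem setLp_le_of_forall_iUnion {d : ℕ} (hd : 1 ≤ d) {p : ℝ} (hp : 0 < p)
    {S : ℕ → Set (EuclideanSpace ℝ (Fin d))} (hS : Monotone S) (hSU : {0}ᶜ ⊆ ⋃ L, S L)
    {f : EuclideanSpace ℝ (Fin d) → ℝ≥0∞} {B : ℝ≥0∞} (h : ∀ L, setLp (S L) p f ≤ B) :
    setLp Set.univ p f ≤ B := by
  have : Nonempty (Fin d) := ⟨⟨0, hd⟩⟩
  have h1 : ∫⁻ x in Set.univ, f x ^ p ≤ B ^ p := by
    calc ∫⁻ x in Set.univ, f x ^ p = ∫⁻ x in {0}ᶜ, f x ^ p := by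
          rw [setLIntegral_univ, restrict_compl_singleton]
      _ ≤ ∫⁻ x in ⋃ L, S L, f x ^ p := lintegral_mono_set hSU
      _ = ⨆ L, ∫⁻ x in S L, f x ^ p := setLIntegral_iUnion_of_directed _ hS.directed_le
      _ ≤ B ^ p := by
          refine iSup_le fun L => ?_
          rw [← setLp_rpow _ hp]
          exact ENNReal.rpow_le_rpow (h L) hp.le
  rw [setLp, one_div]
  exact (ENNReal.rpow_inv_le_iff hp).2 h1

theorem setLp_eq_zero_of_ae {d : ℕ} {p : ℝ} (hp : 0 < p) {γ : ℝ}
    {S : Set (EuclideanSpace ℝ (Fin d))} (hS : MeasurableSet S)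
    {u : EuclideanSpace ℝ (Fin d) → ℝ} (h : ∀ᵐ x, x ∈ S → u x = 0) :
    setLp S p (fun x => ‖‖x‖ ^ γ * u x‖ₑ) = 0 := by
  have h1 : ∫⁻ x in S, ‖‖x‖ ^ γ * u x‖ₑ ^ p = ∫⁻ x in S, 0 := by
    refine setLIntegral_congr_fun_ae hS ?_
    filter_upwards [h] with x hx hxS
    simp [hx hxS, hp]
  rw [setLp, h1, lintegral_zero, ENNReal.zero_rpow_of_pos (by positivity)]

/-- The sum of the geometric series is the fixed point of t ↦ 1 + ct, which closes the inductions
below with a constant independent of the step. -/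
theorem one_add_ofReal_mul_ofReal_inv {c : ℝ} (hc0 : 0 ≤ c) (hc1 : c < 1) :
    1 + ENNReal.ofReal c * ENNReal.ofReal (1 - c)⁻¹ = ENNReal.ofReal (1 - c)⁻¹ := by
  have h1 : 0 < 1 - c := by linarith
  rw [← ENNReal.ofReal_one, ← ENNReal.ofReal_mul hc0,
    ← ENNReal.ofReal_add zero_le_one (by positivity)]
  congr 1
  field_simp
  ring

/-- A function with bounded support is controlled by its dyadic increment. -/
theorem setLp_le_of_bounded_support {d : ℕ} (hd : 1 ≤ d) {τ γ : ℝ} (hτ : 1 ≤ τ)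
    (hs : 0 < d / τ + γ) {u : EuclideanSpace ℝ (Fin d) → ℝ} (hu : AEMeasurable u) {R : ℝ}
    (hR : 0 < R) (huR : ∀ᵐ x, R ≤ ‖x‖ → u x = 0) :
    setLp Set.univ τ (fun x => ‖‖x‖ ^ γ * u x‖ₑ) ≤
      ENNReal.ofReal (1 - 2 ^ (-(d / τ + γ)))⁻¹ *
        setLp Set.univ τ (fun x => ‖‖x‖ ^ γ * (u ((2 : ℝ) • x) - u x)‖ₑ) := by
  have hτ0 : 0 < τ := by linarith
  set c : ℝ := 2 ^ (-(d / τ + γ)) with hc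
  have hc0 : 0 ≤ c := by positivity
  have hc1 : c < 1 := Real.rpow_lt_one_of_one_lt_of_neg one_lt_two (by linarith)
  set D := setLp Set.univ τ (fun x => ‖‖x‖ ^ γ * (u ((2 : ℝ) • x) - u x)‖ₑ)
  have hu2 : AEMeasurable fun x => u ((2 : ℝ) • x) :=
    hu.comp_quasiMeasurePreserving (quasiMeasurePreserving_smul two_pos)
  -- On S 0 the function u vanishes, and doubling carries S (L + 1) to S L. Inducting from there
  -- avoids subtracting a possibly infinite norm of u.
  let S : ℕ → Set (EuclideanSpace ℝ (Fin d)) := fun L => {x | R / 2 ^ L ≤ ‖x‖}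
  have hSm : ∀ L, MeasurableSet (S L) := fun L => measurableSet_le measurable_const measurable_norm
  have hpre : ∀ L, S (L + 1) = (fun x => (2 : ℝ) • x) ⁻¹' S L := by
    intro L
    ext x
    change R / 2 ^ (L + 1) ≤ ‖x‖ ↔ R / 2 ^ L ≤ ‖(2 : ℝ) • x‖
    rw [norm_smul, Real.norm_of_nonneg zero_le_two, pow_succ, div_le_iff₀ (by positivity),
      div_le_iff₀ (by positivity)]
    ring_nf
  refine setLp_le_of_forall_iUnion hd hτ0 (S := S) ?_ ?_ fun L => ?_
  · intro L L' hL x hx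
    exact le_trans (by gcongr; norm_num) (show R / 2 ^ L ≤ ‖x‖ from hx)
  · intro x hx
    obtain ⟨L, hL⟩ := pow_unbounded_of_one_lt (R / ‖x‖) (one_lt_two (α := ℝ))
    rw [Set.mem_iUnion]
    refine ⟨L, ?_⟩
    change R / 2 ^ L ≤ ‖x‖
    rw [div_lt_iff₀ (norm_pos_iff.2 hx)] at hL
    rw [div_le_iff₀ (by positivity)]
    linarith
  · induction L with
    | zero =>
      rw [setLp_eq_zero_of_ae hτ0 (hSm 0) (by simpa [S] using huR)]
      exact zero_le
    | succ L ih =>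
      calc setLp (S (L + 1)) τ (fun x => ‖‖x‖ ^ γ * u x‖ₑ)
          ≤ D + setLp (S (L + 1)) τ (fun x => ‖‖x‖ ^ γ * u ((2 : ℝ) • x)‖ₑ) :=
            setLp_le_add hτ hu hu2 _
        _ = D + ENNReal.ofReal c * setLp (S L) τ (fun x => ‖‖x‖ ^ γ * u x‖ₑ) := by
            rw [hpre, setLp_preimage_smul_eq γ hτ0 (hSm L)]
        _ ≤ D + ENNReal.ofReal c * (ENNReal.ofReal (1 - c)⁻¹ * D) := by gcongr
        _ = (1 + ENNReal.ofReal c * ENNReal.ofReal (1 - c)⁻¹) * D := by ring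
        _ = _ := by rw [one_add_ofReal_mul_ofReal_inv hc0 hc1]

/-- A function vanishing near the origin is controlled by its dyadic increment. -/
theorem setLp_le_of_vanishing_near_zero {d : ℕ} (hd : 1 ≤ d) {τ γ : ℝ} (hτ : 1 ≤ τ)
    (hs : d / τ + γ < 0) {u : EuclideanSpace ℝ (Fin d) → ℝ} (hu : AEMeasurable u) {R : ℝ}
    (hR : 0 < R) (huR : ∀ᵐ x, ‖x‖ ≤ R → u x = 0) :
    setLp Set.univ τ (fun x => ‖‖x‖ ^ γ * u x‖ₑ) ≤
      ENNReal.ofReal (1 - 2 ^ (d / τ + γ))⁻¹ *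
        setLp Set.univ τ (fun x => ‖‖x‖ ^ γ * (u ((2 : ℝ) • x) - u x)‖ₑ) := by
  have hτ0 : 0 < τ := by linarith
  set c : ℝ := 2 ^ (d / τ + γ) with hc
  have hc0 : 0 ≤ c := by positivity
  have hc1 : c < 1 := Real.rpow_lt_one_of_one_lt_of_neg one_lt_two hs
  set D := setLp Set.univ τ (fun x => ‖‖x‖ ^ γ * (u ((2 : ℝ) • x) - u x)‖ₑ) with hD
  have hu2 : AEMeasurable fun x => u ((2 : ℝ) • x) :=
    hu.comp_quasiMeasurePreserving (quasiMeasurePreserving_smul two_pos)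
  -- Now u vanishes on S 0, and S (L + 1) is reached by doubling S L. The contraction therefore has
  -- the inverse factor 2^(d/τ + γ).
  let S : ℕ → Set (EuclideanSpace ℝ (Fin d)) := fun L => {x | ‖x‖ ≤ R * 2 ^ L}
  have hSm : ∀ L, MeasurableSet (S L) := fun L => measurableSet_le measurable_norm measurable_const
  have hpre : ∀ L, S L = (fun x => (2 : ℝ) • x) ⁻¹' S (L + 1) := by
    intro L
    ext x
    change ‖x‖ ≤ R * 2 ^ L ↔ ‖(2 : ℝ) • x‖ ≤ R * 2 ^ (L + 1)
    rw [norm_smul, Real.norm_of_nonneg zero_le_two, pow_succ]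
    constructor <;> intro h <;> linarith
  have hinv : ENNReal.ofReal c * ENNReal.ofReal (2 ^ (-(d / τ + γ))) = 1 := by
    rw [← ENNReal.ofReal_mul hc0, hc, ← Real.rpow_add two_pos]
    simp
  have hDsymm : setLp Set.univ τ (fun x => ‖‖x‖ ^ γ * (u x - u ((2 : ℝ) • x))‖ₑ) = D := by
    have : ∀ x : EuclideanSpace ℝ (Fin d), ‖‖x‖ ^ γ * (u x - u ((2 : ℝ) • x))‖ₑ =
        ‖‖x‖ ^ γ * (u ((2 : ℝ) • x) - u x)‖ₑ := fun x => by
      rw [← enorm_neg]; congr 1; ring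
    simp_rw [this, hD]
  refine setLp_le_of_forall_iUnion hd hτ0 (S := S) ?_ ?_ fun L => ?_
  · intro L L' hL x hx
    exact le_trans (show ‖x‖ ≤ R * 2 ^ L from hx) (by gcongr; norm_num)
  · intro x _
    obtain ⟨L, hL⟩ := pow_unbounded_of_one_lt (‖x‖ / R) (one_lt_two (α := ℝ))
    rw [Set.mem_iUnion]
    refine ⟨L, ?_⟩
    change ‖x‖ ≤ R * 2 ^ L
    rw [div_lt_iff₀ hR] at hL
    linarith
  · induction L with
    | zero =>
      rw [setLp_eq_zero_of_ae hτ0 (hSm 0) (by simpa [S] using huR)]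
      exact zero_le
    | succ L ih =>
      calc setLp (S (L + 1)) τ (fun x => ‖‖x‖ ^ γ * u x‖ₑ)
          = ENNReal.ofReal c * setLp (S L) τ (fun x => ‖‖x‖ ^ γ * u ((2 : ℝ) • x)‖ₑ) := by
            rw [hpre L, setLp_preimage_smul_eq γ hτ0 (hSm (L + 1)), ← mul_assoc, hinv, one_mul]
        _ ≤ ENNReal.ofReal c * (D + setLp (S L) τ (fun x => ‖‖x‖ ^ γ * u x‖ₑ)) := by
            gcongr
            rw [← hDsymm]
            exact setLp_le_add hτ hu2 hu _
        _ ≤ ENNReal.ofReal c * (D + ENNReal.ofReal (1 - c)⁻¹ * D) := by gcongr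
        _ = ENNReal.ofReal c * D + ENNReal.ofReal c * ENNReal.ofReal (1 - c)⁻¹ * D := by ring
        _ ≤ 1 * D + ENNReal.ofReal c * ENNReal.ofReal (1 - c)⁻¹ * D := by
            gcongr
            exact ENNReal.ofReal_le_one.2 hc1.le
        _ = (1 + ENNReal.ofReal c * ENNReal.ofReal (1 - c)⁻¹) * D := by ring
        _ = _ := by rw [one_add_ofReal_mul_ofReal_inv hc0 hc1]

/-! ### Uniqueness of the weak gradient and conclusion -/

theorem eLpNorm_ofReal_eq_setLp {d : ℕ} {F : Type*} [NormedAddCommGroup F] {p : ℝ} (hp : 0 < p)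
    (f : EuclideanSpace ℝ (Fin d) → F) :
    eLpNorm f (ENNReal.ofReal p) volume = setLp Set.univ p (fun x => ‖f x‖ₑ) := by
  rw [eLpNorm_eq_lintegral_rpow_enorm_toReal (by simpa using hp) ENNReal.ofReal_ne_top,
    ENNReal.toReal_ofReal hp.le, setLp, setLIntegral_univ]

/-- The difference integrates to zero against every test function, hence vanishes almost everywhere.
Thus the infimum defining the gradient norm runs over equal values. -/
theorem IsWeakGradientPunctured.ae_eq {d : ℕ} {u : EuclideanSpace ℝ (Fin d) → ℝ}
    {g₁ g₂ : EuclideanSpace ℝ (Fin d) → EuclideanSpace ℝ (Fin d)}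
    (h₁ : IsWeakGradientPunctured u g₁) (h₂ : IsWeakGradientPunctured u g₂) :
    g₁ =ᵐ[volume.restrict {0}ᶜ] g₂ := by
  have hloc : LocallyIntegrableOn (fun x => g₁ x - g₂ x) {0}ᶜ := h₁.1.sub h₂.1
  have key : ∀ᵐ x, x ∈ ({0}ᶜ : Set (EuclideanSpace ℝ (Fin d))) → g₁ x - g₂ x = 0 := by
    refine isOpen_compl_singleton.ae_eq_zero_of_integral_contDiff_smul_eq_zero hloc
      fun φ hφ hφc hφs => ?_
    have hint : ∀ g : EuclideanSpace ℝ (Fin d) → EuclideanSpace ℝ (Fin d),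
        LocallyIntegrableOn g {0}ᶜ → Integrable (fun x => φ x • g x) := by
      intro g hg
      have h1 : IntegrableOn (fun x => φ x • g x) (tsupport φ) :=
        (hg.integrableOn_compact_subset hφs hφc).continuousOn_smul hφ.continuous.continuousOn hφc
      refine (integrableOn_iff_integrable_of_support_subset ?_).1 h1
      exact (Function.support_smul_subset_left _ _).trans (subset_tsupport φ)
    simp_rw [smul_sub]
    rw [integral_sub (hint _ h₁.1) (hint _ h₂.1), sub_eq_zero]
    refine ext_inner_right ℝ fun v => ?_
    have hin : ∀ g : EuclideanSpace ℝ (Fin d) → EuclideanSpace ℝ (Fin d),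
        LocallyIntegrableOn g {0}ᶜ →
          inner ℝ (∫ x, φ x • g x) v = ∫ x, inner ℝ (g x) v * φ x := by
      intro g hg
      rw [real_inner_comm, ← integral_inner (hint g hg)]
      refine integral_congr_ae (Filter.Eventually.of_forall fun x => ?_)
      dsimp only
      rw [real_inner_smul_right, real_inner_comm, mul_comm]
    rw [hin _ h₁.1, hin _ h₂.1, ← neg_inj, ← h₁.2 φ hφ hφc hφs v, ← h₂.2 φ hφ hφc hφs v]
  rw [Filter.EventuallyEq, ae_restrict_iff' (measurableSet_singleton _).compl]
  filter_upwards [key] with x hx hx0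
  exact sub_eq_zero.1 (hx hx0)

theorem weightedGradientLpNorm_eq {d : ℕ} (hd : 1 ≤ d) {α p : ℝ} (hp : 0 < p)
    {u : EuclideanSpace ℝ (Fin d) → ℝ} {g : EuclideanSpace ℝ (Fin d) → EuclideanSpace ℝ (Fin d)}
    (hg : IsWeakGradientPunctured u g) (hgp : MemLpLocPunctured g p) :
    weightedGradientLpNorm α p u = setLp Set.univ p (fun x => ‖‖x‖ ^ α • g x‖ₑ) := by
  have : Nonempty (Fin d) := ⟨⟨0, hd⟩⟩
  rw [← eLpNorm_ofReal_eq_setLp hp, weightedGradientLpNorm]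
  have h : ∀ g', IsWeakGradientPunctured u g' →
      eLpNorm (fun x => ‖x‖ ^ α • g' x) (ENNReal.ofReal p) (volume.restrict {0}ᶜ) =
        eLpNorm (fun x => ‖x‖ ^ α • g x) (ENNReal.ofReal p) volume := by
    intro g' hg'
    refine (eLpNorm_congr_ae (g := fun x => ‖x‖ ^ α • g x) ?_).trans
      (by rw [restrict_compl_singleton])
    filter_upwards [hg'.ae_eq hg] with x hx
    rw [hx]
  refine le_antisymm (iInf₂_le_of_le g ⟨hg, hgp⟩ (h g hg).le) ?_
  exact le_iInf₂ fun g' hg' => (h g' hg'.1).ge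

theorem ae_eq_zero_of_weightedLpNorm_eq_zero {d : ℕ} (hd : 1 ≤ d) {β q : ℝ} (hq : 0 < q)
    {u : EuclideanSpace ℝ (Fin d) → ℝ} (hu : AEMeasurable u) (h : weightedLpNorm β q u = 0) :
    u =ᵐ[volume] 0 := by
  have : Nonempty (Fin d) := ⟨⟨0, hd⟩⟩
  have hm : AEStronglyMeasurable (fun x : EuclideanSpace ℝ (Fin d) => ‖x‖ ^ β * u x) volume :=
    ((measurable_norm.pow_const β).aemeasurable.mul hu).aestronglyMeasurable
  rw [weightedLpNorm, eLpNorm_eq_zero_iff hm (by simpa using hq)] at h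
  filter_upwards [h, compl_mem_ae_iff.2 (measure_singleton (0 : EuclideanSpace ℝ (Fin d)))]
    with x hx hx0
  exact (mul_eq_zero.1 hx).resolve_left (Real.rpow_pos_of_pos (norm_pos_iff.2 hx0) β).ne'

/-- The inequality for `u` follows from the one for every admissible weak gradient of `u`. -/
theorem CKNInequality.of_forall {d : ℕ} (hd : 1 ≤ d) {C p q τ a α β γ : ℝ} (hC : 0 < C)
    (hp : 0 < p) (hq : 0 < q) (hτ : 0 < τ) (ha0 : 0 < a) (ha1 : a ≤ 1)
    {u : EuclideanSpace ℝ (Fin d) → ℝ} (hu : AEMeasurable u)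
    (h : ∀ g, IsWeakGradientPunctured u g →
      setLp Set.univ τ (fun x => ‖‖x‖ ^ γ * u x‖ₑ) ≤ ENNReal.ofReal C *
        (setLp Set.univ p (fun x => ‖‖x‖ ^ α • g x‖ₑ) ^ a *
          setLp Set.univ q (fun x => ‖‖x‖ ^ β * u x‖ₑ) ^ (1 - a))) :
    CKNInequality C p q τ a α β γ u := by
  rw [CKNInequality]
  by_cases hg : ∃ g, IsWeakGradientPunctured u g ∧ MemLpLocPunctured g p
  · obtain ⟨g, hg, hgp⟩ := hg
    rw [weightedGradientLpNorm_eq hd hp hg hgp, weightedLpNorm, weightedLpNorm,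
      eLpNorm_ofReal_eq_setLp hτ, eLpNorm_ofReal_eq_setLp hq]
    exact h g hg
  · have htop : weightedGradientLpNorm α p u = ⊤ := by
      rw [weightedGradientLpNorm]
      exact iInf₂_eq_top.2 fun g hg' => (hg ⟨g, hg'⟩).elim
    rw [htop, ENNReal.top_rpow_of_pos ha0]
    -- Without an admissible gradient the right side is infinite, except for the product ∞·0; in
    -- that case u = 0 almost everywhere and the left side is zero.
    by_cases hV : weightedLpNorm β q u ^ (1 - a) = 0
    · have hV0 : weightedLpNorm β q u = 0 := by
        rcases ENNReal.rpow_eq_zero_iff.1 hV with h | h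
        · exact h.1
        · linarith [h.2]
      have hu0 := ae_eq_zero_of_weightedLpNorm_eq_zero hd hq hu hV0
      have : weightedLpNorm γ τ u = 0 := by
        rw [weightedLpNorm]
        refine (eLpNorm_congr_ae (g := fun _ => (0 : ℝ)) ?_).trans eLpNorm_zero'
        filter_upwards [hu0] with x hx
        simp [hx]
      rw [this]
      exact zero_le
    · rw [ENNReal.top_mul hV, ENNReal.mul_top (by simpa using hC)]
      exact le_top

theorem aemeasurable_of_locallyIntegrableOn_compl_zero {d : ℕ} (hd : 1 ≤ d)
    {u : EuclideanSpace ℝ (Fin d) → ℝ} (hu : LocallyIntegrableOn u {0}ᶜ) : AEMeasurable u := by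
  have : Nonempty (Fin d) := ⟨⟨0, hd⟩⟩
  have h := hu.aestronglyMeasurable
  rw [restrict_compl_singleton] at h
  exact h.aemeasurable

theorem mainTheorem7 (d : ℕ) (hd : 1 ≤ d) (p q τ a α β γ σ : ℝ)
    (hp : 1 ≤ p) (hq : 1 ≤ q) (hτ : 1 ≤ τ) (ha0 : 0 < a) (ha1 : a ≤ 1)
    (hσ : γ = a * σ + (1 - a) * β)
    (hbalance : 1 / τ + γ / d = a * (1 / p + (α - 1) / d) + (1 - a) * (1 / q + β / d))
    (hασ : 0 ≤ α - σ)
    (hborder : 1 / τ + γ / d = 1 / p + (α - 1) / d → α - σ ≤ 1) :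
    ∃ C : ℝ, 0 < C ∧
      (0 < 1 / τ + γ / d →
        ∀ u : EuclideanSpace ℝ (Fin d) → ℝ, LocallyIntegrableOn u {0}ᶜ →
          (∃ K : Set (EuclideanSpace ℝ (Fin d)), IsCompact K ∧ ∀ᵐ x, x ∉ K → u x = 0) →
          CKNInequality C p q τ a α β γ u) ∧
      (1 / τ + γ / d < 0 →
        ∀ u : EuclideanSpace ℝ (Fin d) → ℝ, LocallyIntegrableOn u {0}ᶜ →
          (∃ U ∈ 𝓝 (0 : EuclideanSpace ℝ (Fin d)), ∀ᵐ x, x ∈ U → u x = 0) →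
          CKNInequality C p q τ a α β γ u) := by
  have hd0 : (0 : ℝ) < d := by exact_mod_cast hd
  have hs : d / τ + γ = d * (1 / τ + γ / d) := by field_simp
  obtain ⟨C₀, hC₀, hinc⟩ :=
    exists_setLp_sub_le hd hp hq hτ ha0 ha1 hσ hbalance hασ hborder
  -- Only one of these matters for a given sign of d/τ + γ, since `ENNReal.ofReal` sends the other
  -- to 0. Their sum serves both cases with one constant.
  set c₁ := ENNReal.ofReal (1 - 2 ^ (-(d / τ + γ)))⁻¹ with hc₁
  set c₂ := ENNReal.ofReal (1 - 2 ^ (d / τ + γ))⁻¹ with hc₂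
  set A := (c₁ + c₂) * C₀ with hA
  have hAtop : A ≠ ⊤ :=
    ENNReal.mul_ne_top (ENNReal.add_ne_top.2 ⟨ENNReal.ofReal_ne_top, ENNReal.ofReal_ne_top⟩) hC₀
  -- The added 1 ensures that the final constant is strictly positive.
  have hApos : 0 < A.toReal + 1 := by positivity
  have hAle : A ≤ ENNReal.ofReal (A.toReal + 1) := by
    rw [← ENNReal.ofReal_toReal hAtop]
    exact ENNReal.ofReal_le_ofReal (by simp)
  have main : ∀ u : EuclideanSpace ℝ (Fin d) → ℝ, LocallyIntegrableOn u {0}ᶜ → ∀ c ≤ c₁ + c₂,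
      setLp Set.univ τ (fun x => ‖‖x‖ ^ γ * u x‖ₑ) ≤
        c * setLp Set.univ τ (fun x => ‖‖x‖ ^ γ * (u ((2 : ℝ) • x) - u x)‖ₑ) →
      CKNInequality (A.toReal + 1) p q τ a α β γ u := by
    intro u hu c hc h
    refine CKNInequality.of_forall hd hApos (by linarith) (by linarith) (by linarith) ha0 ha1
      (aemeasurable_of_locallyIntegrableOn_compl_zero hd hu) fun g hg => ?_
    refine (h.trans (mul_le_mul' hc (hinc u g hu hg))).trans ?_
    rw [← mul_assoc]
    exact mul_le_mul' hAle le_rfl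
  refine ⟨A.toReal + 1, hApos, fun hpos u hu hK => ?_, fun hneg u hu hU => ?_⟩
  · obtain ⟨K, hKc, hK⟩ := hK
    obtain ⟨R, hR, hKR⟩ := hKc.isBounded.subset_ball_lt 0 0
    refine main u hu c₁ le_self_add (setLp_le_of_bounded_support hd hτ ?_
      (aemeasurable_of_locallyIntegrableOn_compl_zero hd hu) hR ?_)
    · rw [hs]; positivity
    · filter_upwards [hK] with x hx hxR
      exact hx fun hxK => (mem_ball_zero_iff.1 (hKR hxK)).not_ge hxR
  · obtain ⟨U, hU, hUu⟩ := hU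
    obtain ⟨R, hR, hRU⟩ := Metric.nhds_basis_closedBall.mem_iff.1 hU
    refine main u hu c₂ le_add_self (setLp_le_of_vanishing_near_zero hd hτ ?_
      (aemeasurable_of_locallyIntegrableOn_compl_zero hd hu) hR ?_)
    · rw [hs]; exact mul_neg_of_pos_of_neg hd0 hneg
    · filter_upwards [hUu] with x hx hxR
      exact hx (hRU (mem_closedBall_zero_iff.2 hxR))
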